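/- Let $(M,g)$ be a connected complete smooth Riemannian manifold of dimension $n$ (without boundary), with Riemannian distance $d$, and fix $o\in M$. Let $\hat d:M\to[0,\infty)$ be a smooth function such that $$\Big|\hat d(x)-\tfrac12 d(o,x)\Big|<1\quad\text{and}\quad |\nabla\hat d(x)|\le 1\qquad\text{for all }x\in M,$$ and such that $\nabla\hat d(x)\neq0$ whenever $\hat d(x)$ is a positive integer. For every integer $m\ge 0$ put $D_m=\{x\in M:\hat d(x)<m\}$. For a point $y$ of a complete Riemannian manifold $N$, the cut locus $\mathrm{cut}_y(N)$ is the set of points $x$ at which some minimizing geodesic starting from $y$ ceases to be minimizing: $x$ is the end point of a nonconstant minimizing geodesic from $y$ that cannot be extended beyond $x$ as a minimizing geodesic. Then for every integer $m\ge0$ there exist a connected compact smooth Riemannian manifold $(\tilde M_m,\tilde g_m)$ of dimension $n$, without boundary, and a map $\iota$ from $D_m$ to $\tilde M_m$ such that 1. $\iota$ is a smooth embedding of $D_m$ onto an open subset of $\tilde M_m$ and is isometric in the sense of Riemannian geometry, i.e. $\iota^*\tilde g_m=g$ on $D_m$; 2. for all $x,y\in D_m$, if $x\notin\mathrm{cut}_y(M)$,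 then $\iota(x)\notin\mathrm{cut}_{\iota(y)}(\tilde M_m)$. -/

import Mathlib

open Set Bundle
open scoped Manifold ContDiff Topology

universe u

/-- `IsApproxDistance n o δ`: the function `δ` is a smooth non-negative approximation of half the
distance to `o` on the `n`-dimensional Riemannian manifold `M`, with gradient of norm at most one
and without critical points on the levels `δ = 1`, `δ = 2`, … .  Norms of gradients are norms of
differentials, measured by the Riemannian norm on the tangent spaces. -/
structure IsApproxDistance (n : ℕ) {M : Type*} [MetricSpace M]
    [ChartedSpace (EuclideanSpace ℝ (Fin n)) M]
    [RiemannianBundle (fun x : M ↦ TangentSpace (𝓡 n) x)]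
    (o : M) (δ : M → ℝ) : Prop where
  smooth : ContMDiff (𝓡 n) 𝓘(ℝ, ℝ) ∞ δ
  nonneg : ∀ x, 0 ≤ δ x
  abs_sub_lt : ∀ x, |δ x - dist o x / 2| < 1
  gradient_le : ∀ (x : M) (v : TangentSpace (𝓡 n) x),
    abs (α := ℝ) (mfderiv (𝓡 n) 𝓘(ℝ, ℝ) δ x v) ≤ ‖v‖
  regular : ∀ (k : ℕ), 1 ≤ k → ∀ x, δ x = k → mfderiv (𝓡 n) 𝓘(ℝ, ℝ) δ x ≠ 0

/-- The domain `D_m = {δ < m}`. -/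
def exhaustionDomain {M : Type*} (δ : M → ℝ) (m : ℕ) : Set M := {x | δ x < m}

/-- `ι`, restricted to `D`, is an isometric embedding (in the sense of Riemannian geometry) of `D`
onto an open subset of `N`: it is smooth, a homeomorphism onto an open set, and pulls the metric of
`N` back to the metric of `M`.  Values of `ι` outside the open set `D` play no role. -/
structure IsIsometricOpenEmbeddingOn (n : ℕ) {M N : Type*}
    [MetricSpace M] [ChartedSpace (EuclideanSpace ℝ (Fin n)) M]
    [RiemannianBundle (fun x : M ↦ TangentSpace (𝓡 n) x)]
    [MetricSpace N] [ChartedSpace (EuclideanSpace ℝ (Fin n)) N]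
    [RiemannianBundle (fun x : N ↦ TangentSpace (𝓡 n) x)]
    (ι : M → N) (D : Set M) : Prop where
  isOpen_source : IsOpen D
  smooth : ContMDiffOn (𝓡 n) (𝓡 n) ∞ ι D
  isOpenEmbedding : Topology.IsOpenEmbedding (D.domRestrict ι)
  inner_eq : ∀ x ∈ D, ∀ v w : TangentSpace (𝓡 n) x,
    inner ℝ (mfderiv (𝓡 n) (𝓡 n) ι x v) (mfderiv (𝓡 n) (𝓡 n) ι x w) = inner ℝ v w

/-- `γ` restricted to `[0, l]` is a unit-speed minimizing geodesic: a smooth curve that realizes the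
Riemannian distance between any two of its points. -/
def IsMinimizingGeodesic (n : ℕ) {M : Type*} [MetricSpace M]
    [ChartedSpace (EuclideanSpace ℝ (Fin n)) M] (γ : ℝ → M) (l : ℝ) : Prop :=
  ContMDiffOn 𝓘(ℝ, ℝ) (𝓡 n) ∞ γ (Icc 0 l) ∧
    ∀ s ∈ Icc 0 l, ∀ t ∈ Icc 0 l, dist (γ s) (γ t) = |s - t|

/-- The cut locus of `y` in a complete Riemannian manifold: the points `x` at which some minimizing
geodesic that starts from `y` ceases to be minimizing, that is, `x` is the end point of a
(nonconstant) minimizing geodesic from `y` that has no extension beyond `x` to a longer minimizing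
geodesic. -/
def cutLocus (n : ℕ) {M : Type*} [MetricSpace M]
    [ChartedSpace (EuclideanSpace ℝ (Fin n)) M] (y : M) : Set M :=
  {x | ∃ (l : ℝ) (γ : ℝ → M), 0 < l ∧ IsMinimizingGeodesic n γ l ∧ γ 0 = y ∧ γ l = x ∧
    ¬ ∃ (l' : ℝ) (γ' : ℝ → M), l < l' ∧ IsMinimizingGeodesic n γ' l' ∧ EqOn γ' γ (Icc 0 l)}

/-!
The compact manifold is a double.  For a regular value `k` of `δ` (here `k = 9m + 13`), the set
`{(x, t) | δ x + t² = k} ⊆ M × ℝ` is a regular level set, so it is a closed embedded hypersurface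
(`exists_isSmoothSubsetChart_of_regular`, `isEmbeddedSubmanifold_of_smoothSubsetCharts`).  It is
compact: `δ` differs boundedly from half the distance to `o`, so the sublevel set `{δ ≤ k}` is
bounded, and closed balls of `M` are compact by the Hopf–Rinow theorem
(`HasApproxIntermediatePoints.properSpace`).  Let `N` be its component through `(o, √(k - δ o))`,
with the projections `p : N → M` and `τ : N → ℝ`.  A large ball around `o` embeds into `N` by the
section `ι x = (x, √(k - δ x))`, along which `τ ≥ 1`.

The metric of `N` is `p^* g + χ(τ) dτ²`, where `χ(τ)` is non-negative, positive at the fold `τ = 0`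
and zero for `τ ≥ 1` (`pullbackAddMetric`).  It is positive definite because `dp` is injective away
from the fold (`mul_mfderiv_eq_zero_of_mem_doubleSet`).  The section `ι` is isometric on the ball,
and `p` does not increase norms of tangent vectors on all of `N`.  This is the structure
`IsFoldedExtension`, provided by `exists_isFoldedExtension`.

These two facts determine the cut loci near `o`.  Since `p` does not increase distances and is
inverse to `ι`, the section `ι` preserves the distances of points in the ball of a third of the
radius (`IsFoldedExtension.dist_map`).  A minimizing geodesic of `N` between points of `ι(D_m)` is
short, so its projection stays near `o`, where the fold is out of reach; hence it stays in the image
of `ι` and is the image of a minimizing geodesic of `M`.  When the latter extends beyond its end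
point as a minimizing geodesic, the image of a short extension is a minimizing geodesic of `N`
(`IsFoldedExtension.notMem_cutLocus`).
-/

/-! ### The Hopf–Rinow theorem -/

/-- A metric space has approximately intermediate points when a point at distance `< r + s` can be
reached through a stop at distance `< r` from the start and `< s` from the end.  This is the only
property of length spaces that the Hopf–Rinow theorem needs. -/
def HasApproxIntermediatePoints (X : Type*) [MetricSpace X] : Prop :=
  ∀ (x y : X) (r s : ℝ), 0 < r → 0 < s → dist x y < r + s → ∃ z, dist x z < r ∧ dist z y < s

/-- The Hopf–Rinow–Cohn-Vossen theorem: the closed balls of a complete, locally compact length space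
are compact. -/
theorem HasApproxIntermediatePoints.properSpace {X : Type*} [MetricSpace X] [CompleteSpace X]
    [LocallyCompactSpace X] (h : HasApproxIntermediatePoints X) : ProperSpace X := by
  refine ⟨fun o R ↦ ?_⟩
  -- compactness passes to the limit of increasing radii, by total boundedness
  have closed : ∀ r : ℝ, 0 < r → (∀ r' < r, IsCompact (Metric.closedBall o r')) →
      IsCompact (Metric.closedBall o r) := by
    intro r hr hc
    refine isCompact_iff_totallyBounded_isComplete.2 ⟨?_, Metric.isClosed_closedBall.isComplete⟩
    rw [Metric.totallyBounded_iff]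
    intro ε hε
    have hη : 0 < min (ε / 4) (r / 2) := by positivity
    set η := min (ε / 4) (r / 2) with hη_def
    have hη1 : η ≤ ε / 4 := min_le_left _ _
    have hη2 : η ≤ r / 2 := min_le_right _ _
    obtain ⟨t, ht, hcov⟩ := Metric.totallyBounded_iff.1 (hc (r - η) (by linarith)).totallyBounded
      (ε / 2) (by positivity)
    refine ⟨t, ht, fun x hx ↦ ?_⟩
    obtain ⟨z, hz1, hz2⟩ := h o x (r - η) (2 * η) (by linarith) (by linarith)
      (by rw [dist_comm]; linarith [Metric.mem_closedBall.1 hx])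
    have hz := hcov (Metric.mem_closedBall.2 (by rw [dist_comm]; exact hz1.le) :
      z ∈ Metric.closedBall o (r - η))
    simp only [mem_iUnion, Metric.mem_ball, exists_prop] at hz ⊢
    obtain ⟨y, hy, hzy⟩ := hz
    refine ⟨y, hy, ?_⟩
    linarith [dist_triangle x z y, dist_comm x z]
  -- compactness propagates to slightly larger radii, by local compactness
  have opened : ∀ r : ℝ, 0 ≤ r → IsCompact (Metric.closedBall o r) →
      ∃ r' > r, IsCompact (Metric.closedBall o r') := by
    intro r hr hc
    obtain ⟨K, hK, hrK⟩ := exists_compact_superset hc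
    obtain ⟨η, hη, hsub⟩ := hc.exists_thickening_subset_open isOpen_interior hrK
    refine ⟨r + η / 2, by linarith, hK.of_isClosed_subset Metric.isClosed_closedBall
      fun x hx ↦ interior_subset (hsub ?_)⟩
    have hx' := Metric.mem_closedBall.1 hx
    rw [Metric.mem_thickening_iff]
    rcases hr.eq_or_lt with rfl | hr'
    · exact ⟨o, by simp, by linarith⟩
    · obtain ⟨w, hw1, hw2⟩ := h o x r (3 / 4 * η) hr' (by linarith)
        (by rw [dist_comm]; linarith)
      exact ⟨w, by rw [Metric.mem_closedBall, dist_comm]; exact hw1.le,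
        by rw [dist_comm]; linarith⟩
  by_contra hR
  set A : Set ℝ := {r | 0 ≤ r ∧ IsCompact (Metric.closedBall o r)} with hA
  have h0 : (0 : ℝ) ∈ A := ⟨le_rfl, by simp⟩
  have mono : ∀ r r', r ≤ r' → IsCompact (Metric.closedBall o r') →
      IsCompact (Metric.closedBall o r) := fun r r' hrr hc ↦
    hc.of_isClosed_subset Metric.isClosed_closedBall (Metric.closedBall_subset_closedBall hrr)
  have hbdd : BddAbove A := ⟨R, fun r hr ↦ by
    by_contra hlt
    exact hR (mono R r (le_of_lt (not_le.1 hlt)) hr.2)⟩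
  obtain ⟨r₁, hr₁, hc₁⟩ := opened 0 le_rfl h0.2
  have hpos : 0 < sSup A := lt_of_lt_of_le hr₁ (le_csSup hbdd ⟨hr₁.le, hc₁⟩)
  have hsup : IsCompact (Metric.closedBall o (sSup A)) := closed _ hpos fun r hr ↦ by
    obtain ⟨r', hr', hlt⟩ := exists_lt_of_lt_csSup ⟨0, h0⟩ hr
    exact mono r r' hlt.le hr'.2
  obtain ⟨r₂, hr₂, hc₂⟩ := opened _ hpos.le hsup
  exact absurd (le_csSup hbdd ⟨hpos.le.trans hr₂.le, hc₂⟩) (not_le.2 hr₂)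

section Riemannian

open Manifold

variable {E : Type*} [NormedAddCommGroup E] [NormedSpace ℝ E] {H : Type*} [TopologicalSpace H]
  {I : ModelWithCorners ℝ E H} {M : Type*} [MetricSpace M] [ChartedSpace H M]
  [RiemannianBundle (fun x : M ↦ TangentSpace I x)] [IsRiemannianManifold I M]

variable (I) in
/-- Two points of a Riemannian manifold are joined by a `C^1` curve of length close to their
distance. -/
lemma exists_path_pathELength_lt {x y : M} {r : ℝ} (h : dist x y < r) :
    ∃ γ : ℝ → M, γ 0 = x ∧ γ 1 = y ∧ ContMDiff 𝓘(ℝ, ℝ) I 1 γ ∧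
      pathELength I γ 0 1 < ENNReal.ofReal r := by
  have h' : riemannianEDist I x y < ENNReal.ofReal r := by
    rw [← IsRiemannianManifold.out (I := I) x y, edist_lt_ofReal]
    exact h
  obtain ⟨γ, h0, h1, hγ, hl, -⟩ := exists_lt_locally_constant_of_riemannianEDist_lt h' zero_lt_one
  exact ⟨γ, h0, h1, hγ, hl⟩

lemma edist_le_pathELength {γ : ℝ → M} {a b : ℝ} (hγ : ContMDiff 𝓘(ℝ, ℝ) I 1 γ) (hab : a ≤ b) :
    edist (γ a) (γ b) ≤ pathELength I γ a b := by
  rw [IsRiemannianManifold.out (I := I)]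
  exact riemannianEDist_le_pathELength hγ.contMDiffOn rfl rfl hab

/-- The curves of nearly minimal length provide the stops. -/
lemma hasApproxIntermediatePoints_of_isRiemannianManifold {E : Type*} [NormedAddCommGroup E]
    [NormedSpace ℝ E] {H : Type*} [TopologicalSpace H] (I : ModelWithCorners ℝ E H) (M : Type*)
    [MetricSpace M] [ChartedSpace H M] [RiemannianBundle (fun x : M ↦ TangentSpace I x)]
    [IsRiemannianManifold I M] : HasApproxIntermediatePoints M := by
  intro x y r s hr hs h
  rcases lt_or_ge (dist x y) r with hxy | hxy
  · exact ⟨y, hxy, by simpa using hs⟩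
  obtain ⟨L, hL, hLrs⟩ := exists_between h
  obtain ⟨γ, h0, h1, hγ, hl⟩ := exists_path_pathELength_lt (I := I) hL
  -- the stop is a point of the curve whose distance to `x` is slightly less than `r`
  have hc : Continuous fun t ↦ dist x (γ t) := by
    have := hγ.continuous
    fun_prop
  have hρ : max 0 (L - s) < r := max_lt hr (by linarith)
  obtain ⟨ρ, hρ1, hρ2⟩ := exists_between hρ
  have hρ0 : 0 < ρ := (le_max_left _ _).trans_lt hρ1
  obtain ⟨t, ht, htρ⟩ := intermediate_value_Icc zero_le_one hc.continuousOn
    (show ρ ∈ Icc (dist x (γ 0)) (dist x (γ 1)) by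
      rw [h0, h1, dist_self]; exact ⟨hρ0.le, hρ2.le.trans hxy⟩)
  replace htρ : dist x (γ t) = ρ := htρ
  refine ⟨γ t, htρ ▸ hρ2, ?_⟩
  have e1 := edist_le_pathELength hγ ht.1
  have e2 := edist_le_pathELength hγ ht.2
  rw [h0, edist_dist, htρ] at e1
  rw [h1, edist_dist] at e2
  have : ENNReal.ofReal (ρ + dist (γ t) y) < ENNReal.ofReal L := by
    rw [ENNReal.ofReal_add hρ0.le dist_nonneg]
    exact (add_le_add e1 e2).trans_lt (by rwa [pathELength_add ht.1 ht.2])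
  have := (ENNReal.ofReal_lt_ofReal_iff_of_nonneg (by positivity)).1 this
  linarith [le_max_right 0 (L - s)]

end Riemannian

/-! ### Embedded submanifolds -/

section Submanifold

variable {E : Type*} [NormedAddCommGroup E] [NormedSpace ℝ E] {H : Type*} [TopologicalSpace H]
  {I : ModelWithCorners ℝ E H} {P : Type*} [TopologicalSpace P] [ChartedSpace H P]
  {F : Type*} [NormedAddCommGroup F] [NormedSpace ℝ F]

variable (I) in
/-- A chart `e` of a subset `S` of a manifold `P` is smooth (relative to `P`) when its inverse is
smooth as a map into `P` and `e` is locally the restriction of a smooth map on `P`. -/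
def IsSmoothSubsetChart (S : Set P) (e : OpenPartialHomeomorph S F) : Prop :=
  ContMDiffOn 𝓘(ℝ, F) I ∞ (fun u ↦ (e.symm u : P)) e.target ∧
    ∀ x ∈ e.source, ∃ f : P → F, ContMDiffAt I 𝓘(ℝ, F) ∞ f x ∧ ∀ᶠ y : S in 𝓝 x, f y = e y

variable (I F) in
/-- A subset `S` of a manifold `P`, with an atlas modelled on `F`, is an embedded submanifold when
all charts of the atlas are smooth relative to `P`. -/
class IsEmbeddedSubmanifold (S : Set P) [ChartedSpace F S] : Prop where
  isSmoothSubsetChart : ∀ e ∈ atlas F S, IsSmoothSubsetChart I S e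

/-- The atlas formed by all smooth charts of a subset that has enough of them. -/
@[reducible] noncomputable def chartedSpaceOfSmoothSubsetCharts (S : Set P)
    (h : ∀ x : S, ∃ e : OpenPartialHomeomorph S F, x ∈ e.source ∧ IsSmoothSubsetChart I S e) :
    ChartedSpace F S where
  atlas := {e | IsSmoothSubsetChart I S e}
  chartAt x := (h x).choose
  mem_chart_source x := (h x).choose_spec.1
  chart_mem_atlas x := (h x).choose_spec.2

lemma isEmbeddedSubmanifold_of_smoothSubsetCharts (S : Set P)
    (h : ∀ x : S, ∃ e : OpenPartialHomeomorph S F, x ∈ e.source ∧ IsSmoothSubsetChart I S e) :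
    letI := chartedSpaceOfSmoothSubsetCharts S h
    IsEmbeddedSubmanifold I F S :=
  letI := chartedSpaceOfSmoothSubsetCharts S h
  ⟨fun _ he ↦ he⟩

namespace IsEmbeddedSubmanifold

variable (I) (S : Set P) [ChartedSpace F S]

variable {I} in
theorem isManifold (h : IsEmbeddedSubmanifold I F S) : IsManifold 𝓘(ℝ, F) ∞ S := by
  refine isManifold_of_contDiffOn _ _ _ fun e e' he he' ↦ ?_
  intro u hu
  simp only [mfld_simps] at hu
  obtain ⟨f, hf, hfe⟩ := (h.isSmoothSubsetChart e' he').2 _ hu.2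
  have h1 := ((h.isSmoothSubsetChart e he).1).contMDiffAt (e.open_target.mem_nhds hu.1)
  have h2 : ContMDiffAt 𝓘(ℝ, F) 𝓘(ℝ, F) ∞ (fun u ↦ f (e.symm u)) u :=
    ContMDiffAt.comp u hf h1
  refine (h2.contDiffAt.congr_of_eventuallyEq ?_).contDiffWithinAt
  filter_upwards [(e.continuousAt_symm hu.1).eventually hfe] with v hv
  simpa using hv.symm

lemma contMDiffAt_chartAt [IsManifold 𝓘(ℝ, F) ∞ S] (x y : S) (h : y ∈ (chartAt F x).source) :
    ContMDiffAt 𝓘(ℝ, F) 𝓘(ℝ, F) ∞ (chartAt F x) y :=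
  contMDiffOn_chart.contMDiffAt ((chartAt F x).open_source.mem_nhds h)

variable [IsEmbeddedSubmanifold I F S]

theorem contMDiff_val : ContMDiff 𝓘(ℝ, F) I ∞ (Subtype.val : S → P) := by
  have := isManifold (F := F) (I := I) S ‹_›
  intro x
  have h1 := ((isSmoothSubsetChart (I := I) _ (chart_mem_atlas F x)).1).contMDiffAt
    ((chartAt F x).open_target.mem_nhds (mem_chart_target F x))
  have h2 := ContMDiffAt.comp x h1 (contMDiffAt_chartAt (F := F) S x x (mem_chart_source F x))
  refine h2.congr_of_eventuallyEq ?_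
  filter_upwards [(chartAt F x).open_source.mem_nhds (mem_chart_source F x)] with y hy
  simp [(chartAt F x).left_inv hy]

variable {S} in
/-- A continuous map into an embedded submanifold is smooth when it is smooth into the ambient
manifold. -/
theorem contMDiffAt_of_val {E' : Type*} [NormedAddCommGroup E'] [NormedSpace ℝ E'] {H' : Type*}
    [TopologicalSpace H'] {I' : ModelWithCorners ℝ E' H'} {X : Type*} [TopologicalSpace X]
    [ChartedSpace H' X] {h : X → S} {x : X}
    (hh : ContMDiffAt I' I ∞ (fun y ↦ (h y : P)) x) : ContMDiffAt I' 𝓘(ℝ, F) ∞ h x := by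
  have := isManifold (F := F) (I := I) S ‹_›
  have hc : ContinuousAt h x := Topology.IsInducing.subtypeVal.continuousAt_iff.2 hh.continuousAt
  have hs := mem_chart_source F (h x)
  obtain ⟨f, hf, hfe⟩ := (isSmoothSubsetChart (I := I) _ (chart_mem_atlas F (h x))).2 _ hs
  have h1 : ContMDiffAt I' 𝓘(ℝ, F) ∞ (fun y ↦ chartAt F (h x) (h y)) x := by
    refine (ContMDiffAt.comp x hf hh).congr_of_eventuallyEq ?_
    filter_upwards [hc.eventually hfe] with y hy
    simpa using hy.symm
  have h2 : ContMDiffAt 𝓘(ℝ, F) 𝓘(ℝ, F) ∞ (chartAt F (h x)).symm (chartAt F (h x) (h x)) :=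
    contMDiffOn_chart_symm.contMDiffAt
      ((chartAt F (h x)).open_target.mem_nhds (mem_chart_target F (h x)))
  refine (ContMDiffAt.comp x h2 h1).congr_of_eventuallyEq ?_
  filter_upwards [hc.eventually ((chartAt F (h x)).open_source.mem_nhds hs)] with y hy
  simp [(chartAt F (h x)).left_inv hy]

/-- The inclusion of an embedded submanifold is an immersion. -/
theorem mfderiv_val_injective (x : S) :
    Function.Injective (mfderiv 𝓘(ℝ, F) I (Subtype.val : S → P) x) := by
  have := isManifold (F := F) (I := I) S ‹_›
  have : IsManifold 𝓘(ℝ, F) 1 S := IsManifold.of_le (n := ∞) (by simp)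
  have hs := mem_chart_source F x
  obtain ⟨f, hf, hfe⟩ := (isSmoothSubsetChart (I := I) _ (chart_mem_atlas F x)).2 _ hs
  have hv : MDifferentiableAt 𝓘(ℝ, F) I (Subtype.val : S → P) x :=
    (contMDiff_val (F := F) I S).mdifferentiableAt (by simp)
  have h1 : mfderiv 𝓘(ℝ, F) 𝓘(ℝ, F) (f ∘ (Subtype.val : S → P)) x =
      mfderiv 𝓘(ℝ, F) 𝓘(ℝ, F) (chartAt F x) x :=
    Filter.EventuallyEq.mfderiv_eq (by filter_upwards [hfe] with y hy using hy)
  rw [mfderiv_comp x (hf.mdifferentiableAt (by simp)) hv] at h1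
  have h2 : (mfderiv 𝓘(ℝ, F) 𝓘(ℝ, F) (chartAt F x) x).IsInvertible :=
    isInvertible_mfderiv_extChartAt (I := 𝓘(ℝ, F)) (mem_extChartAt_source (I := 𝓘(ℝ, F)) x)
  intro v w hvw
  apply h2.injective
  rw [← h1]
  exact congrArg (mfderiv I 𝓘(ℝ, F) f x) hvw

end IsEmbeddedSubmanifold

end Submanifold

section Linear

/-- A non-zero functional on an `(r+1)`-dimensional space completes to a linear coordinate system,
with remaining coordinates in any given `r`-dimensional space. -/
lemma exists_continuousLinearEquiv_prod {E F : Type*} [NormedAddCommGroup E] [NormedSpace ℝ E]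
    [NormedAddCommGroup F] [NormedSpace ℝ F] [FiniteDimensional ℝ E] [FiniteDimensional ℝ F]
    (hEF : Module.finrank ℝ E = Module.finrank ℝ F + 1) {ψ : E →L[ℝ] ℝ} (hψ : ψ ≠ 0) :
    ∃ (L : E →L[ℝ] F) (A : E ≃L[ℝ] ℝ × F), (A : E →L[ℝ] ℝ × F) = ψ.prod L := by
  obtain ⟨w, hw⟩ : ∃ w, ψ w ≠ 0 := by
    by_contra! h
    exact hψ (ContinuousLinearMap.ext h)
  have hr : Module.finrank ℝ (LinearMap.range (ψ : E →ₗ[ℝ] ℝ)) = 1 := by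
    have : LinearMap.range (ψ : E →ₗ[ℝ] ℝ) = ⊤ :=
      LinearMap.range_eq_top.2 (LinearMap.surjective (f := (ψ : E →ₗ[ℝ] ℝ)) (fun h ↦ hw (by
        simpa using LinearMap.congr_fun h w)))
    rw [this, finrank_top, Module.finrank_self]
  have hk : Module.finrank ℝ (LinearMap.ker (ψ : E →ₗ[ℝ] ℝ)) = Module.finrank ℝ F := by
    have := LinearMap.finrank_range_add_finrank_ker (ψ : E →ₗ[ℝ] ℝ)
    omega
  let e : LinearMap.ker (ψ : E →ₗ[ℝ] ℝ) ≃ₗ[ℝ] F := LinearEquiv.ofFinrankEq _ _ hk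
  let p : E →ₗ[ℝ] LinearMap.ker (ψ : E →ₗ[ℝ] ℝ) :=
    LinearMap.codRestrict _ (LinearMap.id - (ψ : E →ₗ[ℝ] ℝ).smulRight ((ψ w)⁻¹ • w))
      (fun z ↦ by simp [hw])
  let L : E →L[ℝ] F := LinearMap.toContinuousLinearMap (e.toLinearMap ∘ₗ p)
  have hinj : Function.Injective ((ψ.prod L : E →L[ℝ] ℝ × F) : E →ₗ[ℝ] ℝ × F) := by
    rw [← LinearMap.ker_eq_bot, LinearMap.ker_eq_bot']
    intro z hz
    have hz' : (ψ z, L z) = (0, 0) := hz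
    have h1 : ψ z = 0 := congrArg Prod.fst hz'
    have h2 : e (p z) = 0 := congrArg Prod.snd hz'
    have h3 : ((p z : LinearMap.ker (ψ : E →ₗ[ℝ] ℝ)) : E) = 0 := by
      rw [(LinearEquiv.map_eq_zero_iff e).1 h2]; rfl
    have h4 : z - ψ z • ((ψ w)⁻¹ • w) = 0 := h3
    simpa [h1] using h4
  refine ⟨L, (LinearEquiv.ofInjectiveOfFinrankEq _ hinj ?_).toContinuousLinearEquiv, ?_⟩
  · simp [hEF, add_comm]
  · ext z <;> rfl

end Linear

/-! ### Regular level sets -/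

section RegularLevel

variable {E : Type*} [NormedAddCommGroup E] [NormedSpace ℝ E] [FiniteDimensional ℝ E]
  {F : Type*} [NormedAddCommGroup F] [NormedSpace ℝ F] [FiniteDimensional ℝ F]

/-- A function with non-zero differential at `c` is a coordinate of a smooth coordinate system near
`c`, whose other coordinates are linear. -/
lemma exists_straightening (hEF : Module.finrank ℝ E = Module.finrank ℝ F + 1) {ψ : E → ℝ}
    {W : Set E} (hW : IsOpen W) (hψ : ContDiffOn ℝ ∞ ψ W) {c : E} (hc : c ∈ W)
    (hd : fderiv ℝ ψ c ≠ 0) :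
    ∃ (L : E →L[ℝ] F) (g : OpenPartialHomeomorph E (ℝ × F)), c ∈ g.source ∧ g.source ⊆ W ∧
      (∀ z, g z = (ψ z, L z)) ∧ ContDiffOn ℝ ∞ g.symm g.target := by
  obtain ⟨L, A, hA⟩ := exists_continuousLinearEquiv_prod hEF hd
  have hG : ∀ z ∈ W, ContDiffAt ℝ ∞ (fun z ↦ (ψ z, L z)) z := fun z hz ↦
    (hψ.contDiffAt (hW.mem_nhds hz)).prodMk L.contDiff.contDiffAt
  have hD : ∀ z ∈ W, HasFDerivAt (fun z ↦ (ψ z, L z)) ((fderiv ℝ ψ z).prod L) z := fun z hz ↦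
    ((hψ.contDiffAt (hW.mem_nhds hz)).differentiableAt (by simp)).hasFDerivAt.prodMk
      L.hasFDerivAt
  have hDc : HasFDerivAt (fun z ↦ (ψ z, L z)) (A : E →L[ℝ] ℝ × F) c := by
    rw [hA]; exact hD c hc
  let g₀ := (hG c hc).toOpenPartialHomeomorph _ hDc (by simp)
  -- the differential of the coordinate system is invertible near `c`
  let W' : Set E := W ∩ (fun z ↦ (fderiv ℝ ψ z).prod L) ⁻¹'
    range ((↑) : (E ≃L[ℝ] ℝ × F) → E →L[ℝ] ℝ × F)
  have hcont : ContinuousOn (fun z ↦ (fderiv ℝ ψ z).prod L) W := by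
    have hGW : ContDiffOn ℝ ∞ (fun z ↦ (ψ z, L z)) W := hψ.prodMk L.contDiff.contDiffOn
    exact (hGW.continuousOn_fderiv_of_isOpen hW (by simp)).congr fun z hz ↦ (hD z hz).fderiv.symm
  have hW' : IsOpen W' := hcont.isOpen_inter_preimage hW ContinuousLinearEquiv.isOpen
  have hcW' : c ∈ W' := ⟨hc, A, hA⟩
  refine ⟨L, g₀.restrOpen W' hW', ?_, ?_, fun z ↦ rfl, ?_⟩
  · exact ⟨(hG c hc).mem_toOpenPartialHomeomorph_source hDc (by simp), hcW'⟩
  · exact fun z hz ↦ hz.2.1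
  · intro y hy
    have hz : (g₀.restrOpen W' hW').symm y ∈ W' := ((g₀.restrOpen W' hW').map_target hy).2
    obtain ⟨B, hB⟩ := hz.2
    refine ((g₀.restrOpen W' hW').contDiffAt_symm (f₀' := B) hy ?_ (hG _ hz.1)).contDiffWithinAt
    rw [hB]
    exact hD _ hz.1

variable {H : Type*} [TopologicalSpace H] {I : ModelWithCorners ℝ E H} [I.Boundaryless]
  {P : Type*} [TopologicalSpace P] [ChartedSpace H P] [IsManifold I ∞ P]

/-- The regular value theorem: near a point where the differential of `Φ` does not vanish, the level
set `Φ = 0` (and any relatively open subset of it) has a smooth chart. -/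
theorem exists_isSmoothSubsetChart_of_regular
    (hEF : Module.finrank ℝ E = Module.finrank ℝ F + 1) {Φ : P → ℝ}
    (hΦ : ContMDiff I 𝓘(ℝ, ℝ) ∞ Φ) {U : Set P} (hU : IsOpen U) {S : Set P}
    (hS : S = {p | p ∈ U ∧ Φ p = 0}) (p : S) (hd : mfderiv I 𝓘(ℝ, ℝ) Φ p ≠ 0) :
    ∃ e : OpenPartialHomeomorph S F, p ∈ e.source ∧ IsSmoothSubsetChart I S e := by
  set φ := extChartAt I (p : P) with hφ
  have hpφ : (p : P) ∈ φ.source := mem_extChartAt_source _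
  have hφt : IsOpen φ.target := isOpen_extChartAt_target _
  have hφs : IsOpen φ.source := isOpen_extChartAt_source _
  have hsymm : ContMDiffOn 𝓘(ℝ, E) I ∞ φ.symm φ.target := contMDiffOn_extChartAt_symm _
  have hcφ : ContinuousOn φ φ.source := continuousOn_extChartAt _
  have hψ : ContDiffOn ℝ ∞ (Φ ∘ φ.symm) φ.target := by
    rw [← contMDiffOn_iff_contDiffOn]
    exact hΦ.comp_contMDiffOn hsymm
  have hψd : fderiv ℝ (Φ ∘ φ.symm) (φ p) ≠ 0 := by
    intro h0
    apply hd
    rw [← mfderiv_eq_fderiv] at h0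
    have h1 : MDifferentiableAt 𝓘(ℝ, E) 𝓘(ℝ, ℝ) (Φ ∘ φ.symm) (φ p) :=
      ((contMDiffOn_iff_contDiffOn.2 hψ).contMDiffAt
        (hφt.mem_nhds (φ.map_source hpφ))).mdifferentiableAt (by simp)
    have h2 : MDifferentiableAt I 𝓘(ℝ, E) φ (p : P) :=
      (contMDiffAt_extChartAt (n := 1)).mdifferentiableAt (by simp)
    have h3 : mfderiv I 𝓘(ℝ, ℝ) ((Φ ∘ φ.symm) ∘ φ) (p : P) = mfderiv I 𝓘(ℝ, ℝ) Φ p := by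
      apply Filter.EventuallyEq.mfderiv_eq
      filter_upwards [hφs.mem_nhds hpφ] with y hy
      simp [φ.left_inv hy]
    rw [← h3, mfderiv_comp _ h1 h2, h0]
    exact ContinuousLinearMap.zero_comp _
  obtain ⟨L, g, hcg, hgW, hg, hgs⟩ := exists_straightening hEF hφt hψ (φ.map_source hpφ) hψd
  have hval : Continuous (Subtype.val : S → P) := continuous_subtype_val
  have hmemS : ∀ q, q ∈ S ↔ q ∈ U ∧ Φ q = 0 := fun q ↦ by rw [hS]; rfl
  -- the level set is `{0} × F` in the coordinates `g ∘ φ`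
  have hg0 : ∀ q : S, (q : P) ∈ φ.source → g (φ q) = (0, L (φ q)) := by
    intro q hq
    rw [hg]
    simp [φ.left_inv hq, ((hmemS q).1 q.2).2]
  let inv : F → P := fun u ↦ φ.symm (g.symm ((0 : ℝ), u))
  let T : Set F := {u | ((0 : ℝ), u) ∈ g.target ∧ inv u ∈ U}
  have hinv : ContMDiffOn 𝓘(ℝ, F) I ∞ inv {u | ((0 : ℝ), u) ∈ g.target} := by
    have h1 : ContDiffOn ℝ ∞ (fun u : F ↦ g.symm ((0 : ℝ), u)) {u | ((0 : ℝ), u) ∈ g.target} :=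
      hgs.comp (contDiff_const.prodMk contDiff_id).contDiffOn (fun u hu ↦ hu)
    exact hsymm.comp (contMDiffOn_iff_contDiffOn.2 h1) fun u hu ↦ hgW (g.map_target hu)
  have hT0 : IsOpen {u : F | ((0 : ℝ), u) ∈ g.target} :=
    g.open_target.preimage (by fun_prop)
  have hT : IsOpen T := hinv.continuousOn.isOpen_inter_preimage hT0 hU
  have hinvS : ∀ u ∈ T, inv u ∈ S := by
    intro u hu
    refine (hmemS _).2 ⟨hu.2, ?_⟩
    have h1 := g.right_inv hu.1
    rw [hg] at h1
    exact congrArg Prod.fst h1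
  classical
  -- the value `p` off the level set is never taken on the target
  let e : OpenPartialHomeomorph S F :=
    { toFun := fun q ↦ L (φ q)
      invFun := fun u ↦ if h : inv u ∈ S then ⟨inv u, h⟩ else p
      source := {q | (q : P) ∈ φ.source ∧ φ q ∈ g.source}
      target := T
      map_source' := by
        rintro q ⟨hq1, hq2⟩
        have h1 : ((0 : ℝ), L (φ q)) = g (φ q) := (hg0 q hq1).symm
        refine ⟨by rw [h1]; exact g.map_source hq2, ?_⟩
        simp only [inv]
        rw [h1, g.left_inv hq2, φ.left_inv hq1]
        exact ((hmemS q).1 q.2).1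
      map_target' := by
        intro u hu
        rw [dif_pos (hinvS u hu)]
        have h1 : g.symm ((0 : ℝ), u) ∈ g.source := g.map_target hu.1
        refine ⟨φ.map_target (hgW h1), ?_⟩
        simp only [inv]
        rwa [φ.right_inv (hgW h1)]
      left_inv' := by
        rintro q ⟨hq1, hq2⟩
        have h2 : inv (L (φ q)) = q := by
          simp only [inv]
          rw [← hg0 q hq1, g.left_inv hq2, φ.left_inv hq1]
        rw [dif_pos (by rw [h2]; exact q.2)]
        exact Subtype.ext h2
      right_inv' := by
        intro u hu
        rw [dif_pos (hinvS u hu)]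
        have h1 : g.symm ((0 : ℝ), u) ∈ g.source := g.map_target hu.1
        simp only [inv]
        rw [φ.right_inv (hgW h1)]
        have h2 := g.right_inv hu.1
        rw [hg] at h2
        exact congrArg Prod.snd h2
      open_source := by
        have : IsOpen (φ.source ∩ φ ⁻¹' g.source) := hcφ.isOpen_inter_preimage hφs g.open_source
        exact this.preimage hval
      open_target := hT
      continuousOn_toFun := by
        refine L.continuous.comp_continuousOn ?_
        exact hcφ.comp hval.continuousOn fun q hq ↦ hq.1
      continuousOn_invFun := by
        rw [Topology.IsInducing.subtypeVal.continuousOn_iff]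
        refine (hinv.continuousOn.mono fun u hu ↦ hu.1).congr fun u hu ↦ ?_
        simp [hinvS u hu] }
  refine ⟨e, ⟨hpφ, hcg⟩, ?_, ?_⟩
  · refine (hinv.mono fun u hu ↦ hu.1).congr fun u hu ↦ ?_
    change ((if h : inv u ∈ S then ⟨inv u, h⟩ else p : S) : P) = inv u
    rw [dif_pos (hinvS u hu)]
  · intro q hq
    refine ⟨fun z ↦ L (φ z), ?_, Filter.Eventually.of_forall fun y ↦ rfl⟩
    have h1 : ContMDiffAt I 𝓘(ℝ, E) ∞ φ (q : P) :=
      contMDiffAt_extChartAt' (by simpa [hφ] using hq.1)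
    exact L.contMDiff.contMDiffAt.comp (q : P) h1

end RegularLevel

/-! ### Riemannian metrics pulled back by smooth maps -/

section Metric

/-- The unit ball of a positive definite form on a finite-dimensional space is bounded. -/
lemma isVonNBounded_of_pos {V : Type*} [NormedAddCommGroup V] [NormedSpace ℝ V]
    [FiniteDimensional ℝ V] (B : V →L[ℝ] V →L[ℝ] ℝ) (hB : ∀ v, v ≠ 0 → 0 < B v v) :
    Bornology.IsVonNBounded ℝ {v : V | B v v < 1} := by
  rw [NormedSpace.isVonNBounded_iff]
  rcases subsingleton_or_nontrivial V with hV | hV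
  · exact (Set.toFinite _).isBounded
  -- `c` is the minimum of the form on the unit sphere
  obtain ⟨u, hu, hmin⟩ := (isCompact_sphere (0 : V) 1).exists_isMinOn
    ((NormedSpace.sphere_nonempty (x := (0 : V))).2 zero_le_one)
    (f := fun v ↦ B v v) (B.continuous₂.comp (continuous_id.prodMk continuous_id)).continuousOn
  have hu0 : u ≠ 0 := by rintro rfl; simp at hu
  set c := B u u
  have hc : 0 < c := hB u hu0
  have hlow : ∀ v, c * ‖v‖ ^ 2 ≤ B v v := by
    intro v
    rcases eq_or_ne v 0 with rfl | hv
    · simp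
    have hn : 0 < ‖v‖ := norm_pos_iff.2 hv
    have h1 : c ≤ B (‖v‖⁻¹ • v) (‖v‖⁻¹ • v) := hmin (by simp [norm_smul, hn.ne'])
    simp only [map_smul, smul_apply, smul_eq_mul] at h1
    calc c * ‖v‖ ^ 2 ≤ (‖v‖⁻¹ * (‖v‖⁻¹ * B v v)) * ‖v‖ ^ 2 := by gcongr
      _ = B v v := by field_simp
  refine (Metric.isBounded_closedBall (x := (0 : V)) (r := 1 / c + 1)).subset fun v hv ↦ ?_
  have h1 : c * ‖v‖ ^ 2 < 1 := (hlow v).trans_lt hv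
  have h2 : ‖v‖ ^ 2 < 1 / c := by rw [lt_div_iff₀ hc]; linarith
  rw [mem_closedBall_zero_iff]
  nlinarith [sq_nonneg (‖v‖ - 1), norm_nonneg v]

variable {E : Type*} [NormedAddCommGroup E] [NormedSpace ℝ E] {H : Type*} [TopologicalSpace H]
  {I : ModelWithCorners ℝ E H} {N : Type*} [TopologicalSpace N] [ChartedSpace H N]
  {r : ℕ∞ω}

/-- On a finite-dimensional space, pointwise smooth families of linear maps are smooth. -/
lemma contMDiffAt_clm_of_apply {F G : Type*} [NormedAddCommGroup F] [NormedSpace ℝ F]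
    [FiniteDimensional ℝ F] [NormedAddCommGroup G] [NormedSpace ℝ G] {f : N → F →L[ℝ] G} {x : N}
    (h : ∀ v, ContMDiffAt I 𝓘(ℝ, G) r (fun y ↦ f y v) x) :
    ContMDiffAt I 𝓘(ℝ, F →L[ℝ] G) r f x := by
  let e₁ : F ≃L[ℝ] (Fin (Module.finrank ℝ F) → ℝ) := ContinuousLinearEquiv.ofFinrankEq (by simp)
  let e₂ := (e₁.arrowCongr (1 : G ≃L[ℝ] G)).trans
    (ContinuousLinearEquiv.piRing (Fin (Module.finrank ℝ F)))
  have h1 : ContMDiffAt I 𝓘(ℝ, Fin (Module.finrank ℝ F) → G) r (fun y ↦ e₂ (f y)) x :=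
    contMDiffAt_pi_space.2 fun i ↦ h _
  have h2 := e₂.symm.contDiff.contMDiff.contMDiffAt.comp x h1
  exact h2.congr_of_eventuallyEq (Filter.Eventually.of_forall fun y ↦ by simp)

/-- A family of bilinear forms on the fibres is smooth when it is smooth on the vectors that are
constant in a trivialization. -/
lemma contMDiffAt_bilinear_section {F : Type*} [NormedAddCommGroup F] [NormedSpace ℝ F]
    [FiniteDimensional ℝ F] {V : N → Type*} [TopologicalSpace (TotalSpace F V)]
    [∀ b, TopologicalSpace (V b)] [∀ b, AddCommGroup (V b)] [∀ b, Module ℝ (V b)]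
    [∀ b, IsTopologicalAddGroup (V b)] [∀ b, ContinuousSMul ℝ (V b)]
    [FiberBundle F V] [VectorBundle ℝ F V]
    {g : ∀ b : N, V b →L[ℝ] V b →L[ℝ] ℝ} {x : N}
    (h : ∀ v w : F, ContMDiffAt I 𝓘(ℝ, ℝ) r (fun b ↦ g b ((trivializationAt F V x).symm b v)
      ((trivializationAt F V x).symm b w)) x) :
    ContMDiffAt I (I.prod 𝓘(ℝ, F →L[ℝ] F →L[ℝ] ℝ)) r
      (fun b ↦ TotalSpace.mk' (F →L[ℝ] F →L[ℝ] ℝ) (E := fun b ↦ V b →L[ℝ] V b →L[ℝ] ℝ) b (g b))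
      x := by
  rw [contMDiffAt_section]
  refine contMDiffAt_clm_of_apply fun v ↦ contMDiffAt_clm_of_apply fun w ↦ ?_
  refine (h v w).congr_of_eventuallyEq ?_
  filter_upwards [(trivializationAt F V x).open_baseSet.mem_nhds
    (FiberBundle.mem_baseSet_trivializationAt' x)] with b hb
  simpa [hom_trivializationAt_apply] using inCoordinates_apply_eq₂ (F₃ := ℝ) (ϕ := g b)
    (v := v) (w := w) (E₃ := Bundle.Trivial N ℝ) hb hb (by simp)

variable {E' : Type*} [NormedAddCommGroup E'] [NormedSpace ℝ E'] {H' : Type*}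
  [TopologicalSpace H'] {I' : ModelWithCorners ℝ E' H'} {M : Type*} [TopologicalSpace M]
  [ChartedSpace H' M] [RiemannianBundle (fun x : M ↦ TangentSpace I' x)]

/-- The pullback of a bilinear form by a linear map. -/
noncomputable def pullbackForm {V W : Type*} [AddCommGroup V] [Module ℝ V] [TopologicalSpace V]
    [IsTopologicalAddGroup V] [ContinuousSMul ℝ V] [AddCommGroup W] [Module ℝ W]
    [TopologicalSpace W] [IsTopologicalAddGroup W] [ContinuousSMul ℝ W]
    (B : W →L[ℝ] W →L[ℝ] ℝ) (A : V →L[ℝ] W) : V →L[ℝ] V →L[ℝ] ℝ :=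
  (ContinuousLinearMap.precomp ℝ A).comp (B.comp A)

variable (I I') in
/-- The quadratic form `f^* g + χ dτ²` on a manifold, for smooth maps `f` to a Riemannian manifold
and `τ`, `χ` to the real line. -/
noncomputable def pullbackAddForm (f : N → M) (τ χ : N → ℝ) (b : N) :
    TangentSpace I b →L[ℝ] TangentSpace I b →L[ℝ] ℝ :=
  pullbackForm ((RiemannianBundle.g (E := fun x : M ↦ TangentSpace I' x)).inner (f b))
      (mfderiv I I' f b) +
    χ b • pullbackForm ((RiemannianBundle.g (E := fun x : ℝ ↦ TangentSpace 𝓘(ℝ, ℝ) x)).inner (τ b))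
      (mfderiv I 𝓘(ℝ, ℝ) τ b)

lemma pullbackAddForm_apply (f : N → M) (τ χ : N → ℝ) (b : N) (v w : TangentSpace I b) :
    pullbackAddForm I I' f τ χ b v w = inner ℝ (mfderiv I I' f b v) (mfderiv I I' f b w) +
      χ b * inner ℝ (mfderiv I 𝓘(ℝ, ℝ) τ b v) (mfderiv I 𝓘(ℝ, ℝ) τ b w) := by
  rfl

variable [IsManifold I ∞ N] [IsManifold I' ∞ M]
  [IsContMDiffRiemannianBundle I' ∞ E' (fun x : M ↦ TangentSpace I' x)]

lemma contMDiffAt_inner_mfderiv {f : N → M} (hf : ContMDiff I I' ∞ f)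
    {V W : ∀ b : N, TangentSpace I b} {x : N}
    (hV : ContMDiffAt I I.tangent ∞ (fun b ↦ (⟨b, V b⟩ : TangentBundle I N)) x)
    (hW : ContMDiffAt I I.tangent ∞ (fun b ↦ (⟨b, W b⟩ : TangentBundle I N)) x) :
    ContMDiffAt I 𝓘(ℝ, ℝ) ∞
      (fun b ↦ inner ℝ (mfderiv I I' f b (V b)) (mfderiv I I' f b (W b))) x := by
  have : IsManifold I 1 N := IsManifold.of_le (n := ∞) (by simp)
  have : IsManifold I' 1 M := IsManifold.of_le (n := ∞) (by simp)
  have h := hf.contMDiff_tangentMap (m := ∞) (by simp)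
  exact ContMDiffAt.inner_bundle (b := f) (h.contMDiffAt.comp x hV) (h.contMDiffAt.comp x hW)

variable [FiniteDimensional ℝ E]

/-- The Riemannian metric `f^* g + χ dτ²`, when this form is positive definite. -/
noncomputable def pullbackAddMetric {f : N → M} {τ χ : N → ℝ} (hf : ContMDiff I I' ∞ f)
    (hτ : ContMDiff I 𝓘(ℝ, ℝ) ∞ τ) (hχ : ContMDiff I 𝓘(ℝ, ℝ) ∞ χ)
    (hpos : ∀ b (v : TangentSpace I b), v ≠ 0 → 0 < pullbackAddForm I I' f τ χ b v v) :
    ContMDiffRiemannianMetric I ∞ E (fun x : N ↦ TangentSpace I x) where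
  inner := pullbackAddForm I I' f τ χ
  symm b v w := by
    rw [pullbackAddForm_apply, pullbackAddForm_apply, real_inner_comm,
      real_inner_comm (mfderiv I 𝓘(ℝ, ℝ) τ b v)]
  pos := hpos
  isVonNBounded b := isVonNBounded_of_pos (V := E) (pullbackAddForm I I' f τ χ b) (hpos b)
  contMDiff x := by
    have : IsManifold I 1 N := IsManifold.of_le (n := ∞) (by simp)
    refine contMDiffAt_bilinear_section fun v w ↦ ?_
    have hs : ∀ v : E, ContMDiffAt I I.tangent ∞ (fun b ↦ (⟨b,
        (trivializationAt E (TangentSpace I) x).symm b v⟩ : TangentBundle I N)) x := by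
      intro v
      refine contMDiffAt_section _ |>.2 ?_
      refine (contMDiffAt_const (c := v)).congr_of_eventuallyEq ?_
      filter_upwards [(trivializationAt E (TangentSpace I) x).open_baseSet.mem_nhds
        (FiberBundle.mem_baseSet_trivializationAt' x)] with b hb
      simp [Trivialization.apply_mk_symm _ hb]
    simp only [pullbackAddForm_apply]
    exact (contMDiffAt_inner_mfderiv hf (hs v) (hs w)).add
      (hχ.contMDiffAt.mul (contMDiffAt_inner_mfderiv hτ (hs v) (hs w)))

end Metric

/-! ### The distance of a Riemannian manifold -/

section Distance

open Manifold

variable {E : Type*} [NormedAddCommGroup E] [NormedSpace ℝ E] {H : Type*} [TopologicalSpace H]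
  {I : ModelWithCorners ℝ E H}

section

variable {M : Type*} [MetricSpace M] [ChartedSpace H M]
  [RiemannianBundle (fun x : M ↦ TangentSpace I x)] [IsRiemannianManifold I M]

variable (I) in
/-- Nearby points are joined by a short `C^1` curve, which does not leave the ball. -/
lemma exists_path_pathELength_lt_mem_ball {x y : M} {r : ℝ} (h : dist x y < r) :
    ∃ γ : ℝ → M, γ 0 = x ∧ γ 1 = y ∧ ContMDiff 𝓘(ℝ, ℝ) I 1 γ ∧
      pathELength I γ 0 1 < ENNReal.ofReal r ∧ ∀ t ∈ Icc (0 : ℝ) 1, γ t ∈ Metric.ball x r := by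
  obtain ⟨γ, h0, h1, hγ, hl⟩ := exists_path_pathELength_lt (I := I) h
  refine ⟨γ, h0, h1, hγ, hl, fun t ht ↦ ?_⟩
  have e1 := edist_le_pathELength hγ ht.1
  rw [h0] at e1
  have e2 : pathELength I γ 0 t ≤ pathELength I γ 0 1 := pathELength_mono le_rfl ht.2
  rw [Metric.mem_ball, dist_comm, ← edist_lt_ofReal]
  exact (e1.trans e2).trans_lt hl

lemma isPreconnected_ball_of_isRiemannianManifold {E : Type*} [NormedAddCommGroup E]
    [NormedSpace ℝ E] {H : Type*} [TopologicalSpace H] (I : ModelWithCorners ℝ E H) {M : Type*}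
    [MetricSpace M] [ChartedSpace H M] [RiemannianBundle (fun x : M ↦ TangentSpace I x)]
    [IsRiemannianManifold I M] (x : M) (r : ℝ) : IsPreconnected (Metric.ball x r) := by
  refine isPreconnected_of_forall x fun y hy ↦ ?_
  obtain ⟨γ, h0, h1, hγ, -, hmem⟩ := exists_path_pathELength_lt_mem_ball I
    (by rw [dist_comm]; exact hy : dist x y < r)
  refine ⟨γ '' Icc 0 1, ?_, ⟨0, by simp, h0⟩, ⟨1, by simp, h1⟩,
    isPreconnected_Icc.image _ hγ.continuous.continuousOn⟩
  rintro _ ⟨t, ht, rfl⟩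
  exact hmem t ht

variable {E' : Type*} [NormedAddCommGroup E'] [NormedSpace ℝ E'] {H' : Type*} [TopologicalSpace H']
  {I' : ModelWithCorners ℝ E' H'} {N : Type*} [MetricSpace N] [ChartedSpace H' N]
  [RiemannianBundle (fun x : N ↦ TangentSpace I' x)] [IsRiemannianManifold I' N]

/-- A map whose differential does not increase norms on an open set `D` does not increase distances
from the centre of a ball contained in `D` to other points of the ball. -/
lemma dist_map_le_of_norm_mfderiv_le {f : M → N} {D : Set M} (hD : IsOpen D)
    (hf : ContMDiffOn I I' 1 f D)
    (hd : ∀ x ∈ D, ∀ v : TangentSpace I x, ‖mfderiv I I' f x v‖ ≤ ‖v‖) {x y : M} {ρ : ℝ}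
    (hball : Metric.ball x ρ ⊆ D) (hxy : dist x y < ρ) : dist (f x) (f y) ≤ dist x y := by
  refine le_of_forall_gt fun r hr ↦ ?_
  obtain ⟨γ, h0, h1, hγ, hl, hmem⟩ := exists_path_pathELength_lt_mem_ball I
    (lt_min hr hxy : dist x y < min r ρ)
  have hγD : ∀ t ∈ Icc (0 : ℝ) 1, γ t ∈ D := fun t ht ↦
    hball (Metric.ball_subset_ball (min_le_right _ _) (hmem t ht))
  have hc : ContMDiffOn 𝓘(ℝ, ℝ) I' 1 (f ∘ γ) (Icc 0 1) := hf.comp hγ.contMDiffOn hγD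
  have e1 : edist (f x) (f y) ≤ pathELength I' (f ∘ γ) 0 1 := by
    rw [IsRiemannianManifold.out (I := I')]
    exact riemannianEDist_le_pathELength hc (by simp [h0]) (by simp [h1]) zero_le_one
  have e2 : pathELength I' (f ∘ γ) 0 1 ≤ pathELength I γ 0 1 := by
    rw [pathELength_eq_lintegral_mfderiv_Ioo, pathELength_eq_lintegral_mfderiv_Ioo]
    refine MeasureTheory.setLIntegral_mono' measurableSet_Ioo fun t ht ↦ ?_
    have htD := hγD t (Ioo_subset_Icc_self ht)
    have hft : MDifferentiableAt I I' f (γ t) :=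
      (hf.contMDiffAt (hD.mem_nhds htD)).mdifferentiableAt (by simp)
    rw [mfderiv_comp t hft (hγ.mdifferentiable (by simp) t)]
    exact enorm_le_iff_norm_le.2 (hd _ htD _)
  rw [← edist_lt_ofReal]
  exact (e1.trans e2).trans_lt (hl.trans_le (ENNReal.ofReal_le_ofReal (min_le_left _ _)))

end

section

variable {N : Type*} [TopologicalSpace N] [ChartedSpace H N] [IsManifold I 1 N]
  [RiemannianBundle (fun x : N ↦ TangentSpace I x)]
  [IsContinuousRiemannianBundle E (fun x : N ↦ TangentSpace I x)]

variable (I) in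
/-- Points at finite distance from `x` form a clopen set. -/
lemma riemannianEDist_ne_top [PreconnectedSpace N] (x y : N) : riemannianEDist I x y ≠ ⊤ := by
  have hopen : ∀ z : N, ∀ᶠ w in 𝓝 z, riemannianEDist I z w < 1 := fun z ↦
    eventually_riemannianEDist_lt I z zero_lt_one
  have hcl : IsClopen {y | riemannianEDist I x y ≠ ⊤} := by
    constructor
    · rw [← isOpen_compl_iff, isOpen_iff_mem_nhds]
      intro z hz
      filter_upwards [hopen z] with w hw hxw
      apply hz
      refine ne_top_of_le_ne_top ?_ (riemannianEDist_triangle (y := w))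
      rw [riemannianEDist_comm (x := w)]
      exact ENNReal.add_ne_top.2 ⟨hxw, (hw.trans ENNReal.one_lt_top).ne⟩
    · rw [isOpen_iff_mem_nhds]
      intro z hz
      filter_upwards [hopen z] with w hw
      refine ne_top_of_le_ne_top ?_ (riemannianEDist_triangle (y := z))
      exact ENNReal.add_ne_top.2 ⟨hz, (hw.trans ENNReal.one_lt_top).ne⟩
  have := hcl.eq_univ ⟨x, by simp [riemannianEDist_self]⟩
  exact this.ge (mem_univ y)

variable (I N) in
/-- The distance of a connected Riemannian manifold.  Its topology is, definitionally, the topology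
of the manifold. -/
@[reducible] noncomputable def metricSpaceOfRiemannianMetric [PreconnectedSpace N] [T3Space N] :
    MetricSpace N :=
  letI : EMetricSpace N := EMetricSpace.ofRiemannianMetric I N
  EMetricSpace.toMetricSpace fun x y ↦ riemannianEDist_ne_top I x y

lemma isRiemannianManifold_metricSpaceOfRiemannianMetric [PreconnectedSpace N] [T3Space N] :
    letI : MetricSpace N := metricSpaceOfRiemannianMetric I N
    IsRiemannianManifold I N :=
  letI : MetricSpace N := metricSpaceOfRiemannianMetric I N
  ⟨fun _ _ ↦ rfl⟩

end

end Distance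

/-! ### Folded extensions of a ball and the cut locus -/

section Extension

/-- The Riemannian manifold `N` extends the ball `B = ball o R` of `M`: there are a map `ι` into `N`
(of which only the values on `B` matter) and a folding map `p : N → M` that does not increase norms
of tangent vectors, is isometric on `ι(B)` and is inverse to `ι` there.  The sheets of `p` over `B`
are told apart by the sign of a function `τ` on `N`, positive on `ι(B)`. -/
structure IsFoldedExtension (n : ℕ) {M N : Type*}
    [MetricSpace M] [ChartedSpace (EuclideanSpace ℝ (Fin n)) M]
    [RiemannianBundle (fun x : M ↦ TangentSpace (𝓡 n) x)]
    [MetricSpace N] [ChartedSpace (EuclideanSpace ℝ (Fin n)) N]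
    [RiemannianBundle (fun x : N ↦ TangentSpace (𝓡 n) x)]
    (o : M) (R : ℝ) (ι : M → N) (p : N → M) (τ : N → ℝ) : Prop where
  smooth : ContMDiffOn (𝓡 n) (𝓡 n) ∞ ι (Metric.ball o R)
  smooth_fold : ContMDiff (𝓡 n) (𝓡 n) ∞ p
  continuous_sheet : Continuous τ
  left_inv : ∀ x ∈ Metric.ball o R, p (ι x) = x
  sheet_pos : ∀ x ∈ Metric.ball o R, 0 < τ (ι x)
  sheet_ne_zero : ∀ a, p a ∈ Metric.ball o R → τ a ≠ 0
  right_inv : ∀ a, p a ∈ Metric.ball o R → 0 < τ a → ι (p a) = a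
  inner_fold : ∀ x ∈ Metric.ball o R, ∀ v w : TangentSpace (𝓡 n) (ι x),
    inner ℝ (mfderiv (𝓡 n) (𝓡 n) p (ι x) v) (mfderiv (𝓡 n) (𝓡 n) p (ι x) w) = inner ℝ v w
  norm_fold_le : ∀ (a : N) (v : TangentSpace (𝓡 n) a), ‖mfderiv (𝓡 n) (𝓡 n) p a v‖ ≤ ‖v‖

variable {n : ℕ} {M N : Type*} [MetricSpace M] [ChartedSpace (EuclideanSpace ℝ (Fin n)) M]
  [RiemannianBundle (fun x : M ↦ TangentSpace (𝓡 n) x)]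
  [MetricSpace N] [ChartedSpace (EuclideanSpace ℝ (Fin n)) N]
  [RiemannianBundle (fun x : N ↦ TangentSpace (𝓡 n) x)]

/-- The differential of a map that is the identity near `x` preserves inner products.  (The base
points `f x` and `x` of the fibres are equal only propositionally.) -/
lemma inner_mfderiv_of_eventuallyEq_id {f : M → M} {x : M} (h : f =ᶠ[𝓝 x] id)
    (v w : TangentSpace (𝓡 n) x) :
    inner ℝ (mfderiv (𝓡 n) (𝓡 n) f x v) (mfderiv (𝓡 n) (𝓡 n) f x w) = inner ℝ v w := by
  let G : M → EuclideanSpace ℝ (Fin n) → EuclideanSpace ℝ (Fin n) → ℝ := fun y v w ↦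
    inner ℝ (show TangentSpace (𝓡 n) y from v) (show TangentSpace (𝓡 n) y from w)
  have h1 : mfderiv (𝓡 n) (𝓡 n) f x = mfderiv (𝓡 n) (𝓡 n) id x := h.mfderiv_eq
  have h2 : ∀ u : TangentSpace (𝓡 n) x,
      (show EuclideanSpace ℝ (Fin n) from mfderiv (𝓡 n) (𝓡 n) f x u) = u := by
    intro u
    rw [h1, mfderiv_id]
    rfl
  have h3 : f x = x := h.eq_of_nhds
  change G (f x) (mfderiv (𝓡 n) (𝓡 n) f x v) (mfderiv (𝓡 n) (𝓡 n) f x w) = G x v w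
  rw [h3]
  exact congrArg₂ (G x) (h2 v) (h2 w)

namespace IsFoldedExtension

variable {o : M} {R : ℝ} {ι : M → N} {p : N → M} {τ : N → ℝ}

lemma inner_mfderiv (h : IsFoldedExtension n o R ι p τ) {x : M} (hx : x ∈ Metric.ball o R)
    (v w : TangentSpace (𝓡 n) x) :
    inner ℝ (mfderiv (𝓡 n) (𝓡 n) ι x v) (mfderiv (𝓡 n) (𝓡 n) ι x w) = inner ℝ v w := by
  have hid : p ∘ ι =ᶠ[𝓝 x] id := by
    filter_upwards [Metric.isOpen_ball.mem_nhds hx] with y hy using h.left_inv y hy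
  rw [← h.inner_fold x hx, ← inner_mfderiv_of_eventuallyEq_id hid v w,
    mfderiv_comp x (h.smooth_fold.mdifferentiable (by simp) _)
      ((h.smooth.contMDiffAt (Metric.isOpen_ball.mem_nhds hx)).mdifferentiableAt (by simp))]
  rfl

lemma norm_mfderiv (h : IsFoldedExtension n o R ι p τ) {x : M} (hx : x ∈ Metric.ball o R)
    (v : TangentSpace (𝓡 n) x) : ‖mfderiv (𝓡 n) (𝓡 n) ι x v‖ = ‖v‖ := by
  rw [norm_eq_sqrt_real_inner, norm_eq_sqrt_real_inner, h.inner_mfderiv hx]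

theorem isIsometricOpenEmbeddingOn (h : IsFoldedExtension n o R ι p τ) {D : Set M} (hD : IsOpen D)
    (hDR : D ⊆ Metric.ball o R) : IsIsometricOpenEmbeddingOn n ι D where
  isOpen_source := hD
  smooth := h.smooth.mono hDR
  inner_eq x hx := h.inner_mfderiv (hDR hx)
  isOpenEmbedding := by
    refine .of_continuous_injective_isOpenMap ?_ ?_ ?_
    · exact (h.smooth.mono hDR).continuousOn.domRestrict
    · intro x y hxy
      have hxy' : ι x = ι y := hxy
      apply Subtype.ext
      rw [← h.left_inv x (hDR x.2), hxy', h.left_inv y (hDR y.2)]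
    · intro V hV
      have hV' : IsOpen ((↑) '' V : Set M) := hD.isOpenMap_subtype_val V hV
      have : D.domRestrict ι '' V = p ⁻¹' ((↑) '' V) ∩ {a | 0 < τ a} := by
        ext a
        constructor
        · rintro ⟨x, hx, rfl⟩
          refine ⟨?_, h.sheet_pos _ (hDR x.2)⟩
          rw [mem_preimage]
          exact ⟨x, hx, (h.left_inv _ (hDR x.2)).symm⟩
        · rintro ⟨⟨x, hx, hxa⟩, ha⟩
          refine ⟨x, hx, ?_⟩
          change ι x = a
          rw [hxa, h.right_inv a (hxa ▸ hDR x.2) ha]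
      rw [this]
      exact (hV'.preimage h.smooth_fold.continuous).inter
        (isOpen_lt continuous_const h.continuous_sheet)

variable [IsRiemannianManifold (𝓡 n) M] [IsRiemannianManifold (𝓡 n) N]

lemma dist_fold_le (h : IsFoldedExtension n o R ι p τ) (a b : N) : dist (p a) (p b) ≤ dist a b :=
  dist_map_le_of_norm_mfderiv_le (I := 𝓡 n) (I' := 𝓡 n) isOpen_univ
    (h.smooth_fold.of_le (by simp)).contMDiffOn (fun a _ v ↦ h.norm_fold_le a v)
    (subset_univ (Metric.ball a (dist a b + 1))) (by linarith)

/-- `ι` preserves distances near the centre: almost shortest curves between points of the ball of a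
third of the radius do not leave the large ball, where `ι` is isometric, and
the folding map gives the converse inequality. -/
lemma dist_map (h : IsFoldedExtension n o R ι p τ) {x y : M} (hx : x ∈ Metric.ball o (R / 3))
    (hy : y ∈ Metric.ball o (R / 3)) : dist (ι x) (ι y) = dist x y := by
  rw [Metric.mem_ball] at hx hy
  have hR : 0 < R := by linarith [dist_nonneg (x := x) (y := o)]
  apply le_antisymm
  · refine dist_map_le_of_norm_mfderiv_le (I := 𝓡 n) (I' := 𝓡 n) (ρ := 2 * R / 3)
      Metric.isOpen_ball (h.smooth.of_le (by simp)) (fun x hx v ↦ (h.norm_mfderiv hx v).le) ?_ ?_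
    · exact Metric.ball_subset_ball' (by linarith)
    · linarith [dist_triangle_right x y o]
  · have hxR : x ∈ Metric.ball o R := by rw [Metric.mem_ball]; linarith
    have hyR : y ∈ Metric.ball o R := by rw [Metric.mem_ball]; linarith
    simpa [h.left_inv x hxR, h.left_inv y hyR] using h.dist_fold_le (ι x) (ι y)

/-- Minimizing geodesics of `N` between points of the image of a small ball come from `M`: their
projections to `M` stay close to `o`, so that they cannot change sheets.  Conversely, minimizing
geodesics of `M` that stay close to `o` are mapped to minimizing geodesics.  All curves involved
have length at most `2r + 1` and start in the ball of radius `r`, so they stay in the ball of radius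
`3r + 1 ≤ R / 3`. -/
theorem notMem_cutLocus (h : IsFoldedExtension n o R ι p τ) {r : ℝ} (hr : 9 * r + 3 ≤ R) {x y : M}
    (hx : x ∈ Metric.ball o r) (hy : y ∈ Metric.ball o r) (hxy : x ∉ cutLocus n y) :
    ι x ∉ cutLocus n (ι y) := by
  rintro ⟨l, γ, hl, hγ, hγ0, hγl, hno⟩
  rw [Metric.mem_ball] at hx hy
  have hr0 : 0 < r := dist_nonneg.trans_lt hx
  have sub : Metric.ball o (R / 3) ⊆ Metric.ball o R := Metric.ball_subset_ball (by linarith)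
  have hxR : x ∈ Metric.ball o (R / 3) := by rw [Metric.mem_ball]; linarith
  have hyR : y ∈ Metric.ball o (R / 3) := by rw [Metric.mem_ball]; linarith
  have h0l : (0 : ℝ) ∈ Icc 0 l := ⟨le_rfl, hl.le⟩
  have hll : l ∈ Icc 0 l := ⟨hl.le, le_rfl⟩
  have hlr : l < 2 * r := by
    have h1 := hγ.2 0 h0l l hll
    rw [hγ0, hγl, h.dist_map hyR hxR, zero_sub, abs_neg, abs_of_pos hl] at h1
    linarith [dist_triangle_right y x o]
  have hmem : ∀ s ∈ Icc 0 l, p (γ s) ∈ Metric.ball o (R / 3) := by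
    intro s hs
    have h1 := h.dist_fold_le (γ s) (γ 0)
    rw [hγ.2 s hs 0 h0l, hγ0, h.left_inv y (sub hyR), sub_zero, abs_of_nonneg hs.1] at h1
    rw [Metric.mem_ball]
    linarith [dist_triangle (p (γ s)) y o, hs.2]
  -- the sign of `τ` cannot change along `γ`
  have hτ : ∀ s ∈ Icc 0 l, 0 < τ (γ s) := by
    intro s hs
    by_contra hneg
    have hcont : ContinuousOn (fun s ↦ τ (γ s)) (Icc 0 l) :=
      h.continuous_sheet.comp_continuousOn hγ.1.continuousOn
    have h0 : 0 < τ (γ 0) := by rw [hγ0]; exact h.sheet_pos y (sub hyR)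
    obtain ⟨t, ht, hzero⟩ := isPreconnected_Icc.intermediate_value hs h0l hcont
      (show (0 : ℝ) ∈ Icc (τ (γ s)) (τ (γ 0)) from ⟨not_lt.1 hneg, h0.le⟩)
    exact h.sheet_ne_zero _ (sub (hmem t ht)) hzero
  have hback : ∀ s ∈ Icc 0 l, ι (p (γ s)) = γ s := fun s hs ↦
    h.right_inv _ (sub (hmem s hs)) (hτ s hs)
  have hproj : IsMinimizingGeodesic n (p ∘ γ) l := by
    refine ⟨h.smooth_fold.comp_contMDiffOn hγ.1, fun s hs t ht ↦ ?_⟩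
    rw [← hγ.2 s hs t ht, ← hback s hs, ← hback t ht, h.dist_map (hmem s hs) (hmem t ht)]
    rfl
  have hext : ∃ (l' : ℝ) (γ' : ℝ → M), l < l' ∧ IsMinimizingGeodesic n γ' l' ∧
      EqOn γ' (p ∘ γ) (Icc 0 l) := by
    by_contra hcon
    refine hxy ⟨l, p ∘ γ, hl, hproj, ?_, ?_, hcon⟩
    · simp [hγ0, h.left_inv y (sub hyR)]
    · simp [hγl, h.left_inv x (sub hxR)]
  obtain ⟨l', γ', hll', hγ', heq⟩ := hext
  -- only a short piece of the extension is sure to stay close to `o`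
  have hle : min l' (l + 1) ≤ l' := min_le_left _ _
  have hle1 : min l' (l + 1) ≤ l + 1 := min_le_right _ _
  have hsub : Icc 0 (min l' (l + 1)) ⊆ Icc 0 l' := Icc_subset_Icc_right hle
  have hγ'0 : γ' 0 = y := by
    rw [heq h0l, Function.comp_apply, hγ0, h.left_inv y (sub hyR)]
  have hmem' : ∀ s ∈ Icc 0 (min l' (l + 1)), γ' s ∈ Metric.ball o (R / 3) := by
    intro s hs
    have h1 := hγ'.2 s (hsub hs) 0 ⟨le_rfl, by linarith⟩
    rw [hγ'0, sub_zero, abs_of_nonneg hs.1] at h1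
    rw [Metric.mem_ball]
    linarith [dist_triangle (γ' s) y o, hs.2]
  refine hno ⟨min l' (l + 1), ι ∘ γ', lt_min hll' (by linarith), ⟨?_, ?_⟩, ?_⟩
  · exact h.smooth.comp (hγ'.1.mono hsub) fun s hs ↦ sub (hmem' s hs)
  · intro s hs t ht
    rw [Function.comp_apply, Function.comp_apply, h.dist_map (hmem' s hs) (hmem' t ht)]
    exact hγ'.2 s (hsub hs) t (hsub ht)
  · intro s hs
    rw [Function.comp_apply, heq hs, Function.comp_apply, hback s hs]

end IsFoldedExtension

end Extension

/-! ### The double of a sublevel set -/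

section Component

/-- Components of a locally connected subset are relatively open. -/
lemma exists_isOpen_connectedComponentIn_eq {X : Type*} [TopologicalSpace X] {Z : Set X}
    [LocallyConnectedSpace Z] {x : X} (hx : x ∈ Z) :
    ∃ U : Set X, IsOpen U ∧ connectedComponentIn Z x = {y | y ∈ U ∧ y ∈ Z} := by
  obtain ⟨U, hU, hUeq⟩ := isOpen_induced_iff.1
    (isOpen_connectedComponent (x := (⟨x, hx⟩ : Z)))
  refine ⟨U, hU, ?_⟩
  rw [connectedComponentIn_eq_image hx, ← hUeq, Subtype.image_preimage_coe]
  ext y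
  exact and_comm

lemma isClosed_connectedComponentIn {X : Type*} [TopologicalSpace X] {Z : Set X} (hZ : IsClosed Z)
    {x : X} (hx : x ∈ Z) : IsClosed (connectedComponentIn Z x) := by
  rw [connectedComponentIn_eq_image hx]
  exact hZ.isClosedEmbedding_subtypeVal.isClosedMap _ isClosed_connectedComponent

end Component

section Double

variable {n : ℕ} {M : Type*} [MetricSpace M] [ChartedSpace (EuclideanSpace ℝ (Fin n)) M]

/-- The function on `M × ℝ` whose zero set is the double of the sublevel set `{δ ≤ k}`. -/
def doubleFunction (δ : M → ℝ) (k : ℝ) (q : M × ℝ) : ℝ := δ q.1 + q.2 ^ 2 - k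

/-- The double `{(x, t) | δ x + t² = k}` of the sublevel set `{δ ≤ k}`. -/
def doubleSet (δ : M → ℝ) (k : ℝ) : Set (M × ℝ) := {q | doubleFunction δ k q = 0}

lemma contMDiff_doubleFunction {δ : M → ℝ} (hδ : ContMDiff (𝓡 n) 𝓘(ℝ, ℝ) ∞ δ) (k : ℝ) :
    ContMDiff ((𝓡 n).prod 𝓘(ℝ, ℝ)) 𝓘(ℝ, ℝ) ∞ (doubleFunction δ k) := by
  have h1 : ContMDiff ((𝓡 n).prod 𝓘(ℝ, ℝ)) 𝓘(ℝ, ℝ) ∞ (fun q : M × ℝ ↦ q.2) := contMDiff_snd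
  exact ((hδ.comp contMDiff_fst).add (h1.pow 2)).sub contMDiff_const

/-- If `k` is a regular value of `δ`, then the double is cut out regularly. -/
lemma mfderiv_doubleFunction_ne_zero {δ : M → ℝ} (hδ : ContMDiff (𝓡 n) 𝓘(ℝ, ℝ) ∞ δ) {k : ℝ}
    (hreg : ∀ x, δ x = k → mfderiv (𝓡 n) 𝓘(ℝ, ℝ) δ x ≠ 0) {q : M × ℝ} (hq : q ∈ doubleSet δ k) :
    mfderiv ((𝓡 n).prod 𝓘(ℝ, ℝ)) 𝓘(ℝ, ℝ) (doubleFunction δ k) q ≠ 0 := by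
  intro h0
  obtain ⟨x, t⟩ := q
  have hd := (contMDiff_doubleFunction hδ k).mdifferentiable (by simp) (x, t)
  -- the differential vanishes along both factors
  have h1 : mfderiv 𝓘(ℝ, ℝ) 𝓘(ℝ, ℝ) (doubleFunction δ k ∘ fun s : ℝ ↦ (x, s)) t = 0 := by
    rw [mfderiv_comp t hd
      ((contMDiff_const.prodMk contMDiff_id : ContMDiff 𝓘(ℝ, ℝ) ((𝓡 n).prod 𝓘(ℝ, ℝ)) 1
        fun s : ℝ ↦ (x, s)).mdifferentiable (by simp) t), h0]
    exact ContinuousLinearMap.zero_comp _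
  have h2 : mfderiv (𝓡 n) 𝓘(ℝ, ℝ) (doubleFunction δ k ∘ fun y : M ↦ (y, t)) x = 0 := by
    rw [mfderiv_comp (f := fun y : M ↦ (y, t)) x hd
      ((contMDiff_id.prodMk contMDiff_const : ContMDiff (𝓡 n) ((𝓡 n).prod 𝓘(ℝ, ℝ)) 1
        fun y : M ↦ (y, t)).mdifferentiable (by simp) x), h0]
    exact ContinuousLinearMap.zero_comp _
  have h3 : HasDerivAt (doubleFunction δ k ∘ fun s : ℝ ↦ (x, s)) (2 * t) t :=
    (((hasDerivAt_pow 2 t).const_add (δ x)).sub_const k).congr_deriv (by simp)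
  have ht : t = 0 := by
    rw [mfderiv_eq_fderiv] at h1
    have h4 : fderiv ℝ (doubleFunction δ k ∘ fun s : ℝ ↦ (x, s)) t 1 = 0 := by
      rw [h1]; rfl
    rw [h3.hasFDerivAt.fderiv] at h4
    simpa using h4
  have hx : δ x = k := by
    have : δ x + t ^ 2 - k = 0 := hq
    rw [ht] at this
    linarith
  apply hreg x hx
  have h5 : HasMFDerivAt (𝓡 n) 𝓘(ℝ, ℝ) (fun y ↦ doubleFunction δ k (y, t)) x
      (mfderiv (𝓡 n) 𝓘(ℝ, ℝ) δ x) := by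
    have h6 := (hδ.mdifferentiable (by simp) x).hasMFDerivAt
    have h7 : HasMFDerivAt (𝓡 n) 𝓘(ℝ, ℝ) (fun _ : M ↦ t ^ 2 - k) x
      (0 : TangentSpace (𝓡 n) x →L[ℝ] ℝ) := hasMFDerivAt_const _ _
    have h8 := h6.add h7
    have h9 : (fun y ↦ doubleFunction δ k (y, t)) = δ + fun _ ↦ t ^ 2 - k := by
      funext y
      simp only [doubleFunction, Pi.add_apply]
      ring
    rw [h9]
    exact h8.congr_mfderiv (add_zero _)
  rw [← h5.mfderiv]
  exact h2

variable [IsManifold (𝓡 n) ∞ M]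

/-- Relatively open subsets of the double have smooth charts. -/
lemma exists_isSmoothSubsetChart_doubleSet {δ : M → ℝ} (hδ : ContMDiff (𝓡 n) 𝓘(ℝ, ℝ) ∞ δ) {k : ℝ}
    (hreg : ∀ x, δ x = k → mfderiv (𝓡 n) 𝓘(ℝ, ℝ) δ x ≠ 0) {U S : Set (M × ℝ)} (hU : IsOpen U)
    (hS : S = {q | q ∈ U ∧ q ∈ doubleSet δ k}) (q : S) :
    ∃ e : OpenPartialHomeomorph S (EuclideanSpace ℝ (Fin n)), q ∈ e.source ∧
      IsSmoothSubsetChart ((𝓡 n).prod 𝓘(ℝ, ℝ)) S e := by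
  have hq : (q : M × ℝ) ∈ doubleSet δ k := (hS.subset q.2).2
  exact exists_isSmoothSubsetChart_of_regular (by simp) (contMDiff_doubleFunction hδ k) hU hS q
    (mfderiv_doubleFunction_ne_zero hδ hreg hq)

lemma locallyConnectedSpace_doubleSet {δ : M → ℝ} (hδ : ContMDiff (𝓡 n) 𝓘(ℝ, ℝ) ∞ δ) {k : ℝ}
    (hreg : ∀ x, δ x = k → mfderiv (𝓡 n) 𝓘(ℝ, ℝ) δ x ≠ 0) :
    LocallyConnectedSpace (doubleSet δ k) :=
  letI := chartedSpaceOfSmoothSubsetCharts (doubleSet δ k)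
    (exists_isSmoothSubsetChart_doubleSet hδ hreg isOpen_univ (by simp))
  ChartedSpace.locallyConnectedSpace (EuclideanSpace ℝ (Fin n)) (doubleSet δ k)

lemma isCompact_doubleSet {δ : M → ℝ} (hδ : Continuous δ) (hδ0 : ∀ x, 0 ≤ δ x) {k : ℝ}
    (hk : IsCompact {x | δ x ≤ k}) : IsCompact (doubleSet δ k) := by
  refine (hk.prod (isCompact_Icc (a := -(|k| + 1)) (b := |k| + 1))).of_isClosed_subset ?_ ?_
  · have : Continuous (doubleFunction δ k) := by
      unfold doubleFunction
      fun_prop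
    exact isClosed_eq this continuous_const
  · rintro ⟨x, t⟩ hq
    have hq' : δ x + t ^ 2 - k = 0 := hq
    refine ⟨?_, abs_le.1 ?_⟩
    · change δ x ≤ k
      nlinarith [sq_nonneg t]
    · change |t| ≤ |k| + 1
      have h1 : |t| ^ 2 ≤ |k| := by
        rw [sq_abs]
        linarith [hδ0 x, le_abs_self k]
      nlinarith [abs_nonneg t, sq_nonneg (|t| - 1)]

end Double

/-! ### The double as a folded extension -/

section DoubleSection

/-- The section `x ↦ (x, √(k - δ x))` of the double. -/
noncomputable def doubleSection {M : Type*} (δ : M → ℝ) (k : ℝ) (x : M) : M × ℝ := (x, √(k - δ x))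

lemma doubleSection_mem {M : Type*} {δ : M → ℝ} {k : ℝ} {x : M} (hx : δ x ≤ k) :
    doubleSection δ k x ∈ doubleSet δ k := by
  change δ x + √(k - δ x) ^ 2 - k = 0
  rw [Real.sq_sqrt (by linarith)]
  ring

lemma doubleSection_fst_of_mem {M : Type*} {δ : M → ℝ} {k : ℝ} {q : M × ℝ}
    (hq : q ∈ doubleSet δ k) (h : 0 < q.2) : doubleSection δ k q.1 = q := by
  have hq' : δ q.1 + q.2 ^ 2 - k = 0 := hq
  refine Prod.ext rfl ?_
  change √(k - δ q.1) = q.2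
  rw [show k - δ q.1 = q.2 ^ 2 by linarith, Real.sqrt_sq h.le]

variable {n : ℕ} {M : Type*} [MetricSpace M] [ChartedSpace (EuclideanSpace ℝ (Fin n)) M]

lemma contMDiffAt_doubleSection {δ : M → ℝ} (hδ : ContMDiff (𝓡 n) 𝓘(ℝ, ℝ) ∞ δ) {k : ℝ} {x : M}
    (hx : δ x < k) :
    ContMDiffAt (𝓡 n) ((𝓡 n).prod 𝓘(ℝ, ℝ)) ∞ (doubleSection δ k) x := by
  refine contMDiffAt_id.prodMk ?_
  have h1 : ContMDiffAt (𝓡 n) 𝓘(ℝ, ℝ) ∞ (fun x ↦ k - δ x) x :=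
    contMDiffAt_const.sub hδ.contMDiffAt
  have h2 : ContMDiffAt 𝓘(ℝ, ℝ) 𝓘(ℝ, ℝ) ∞ Real.sqrt (k - δ x) :=
    (Real.contDiffAt_sqrt (by linarith)).contMDiffAt
  exact h2.comp x h1

/-- Differentiating `δ x + t² = k`: away from the fold `t = 0`, a tangent vector of the double with
zero component along `M` has zero component `dτ` along `ℝ`. -/
lemma mul_mfderiv_eq_zero_of_mem_doubleSet {E H : Type*} [NormedAddCommGroup E] [NormedSpace ℝ E]
    [TopologicalSpace H] {I : ModelWithCorners ℝ E H} {N : Type*} [TopologicalSpace N]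
    [ChartedSpace H N] {δ : M → ℝ} (hδ : ContMDiff (𝓡 n) 𝓘(ℝ, ℝ) ∞ δ) {k : ℝ} {p : N → M}
    {τ : N → ℝ} {a : N} (hp : MDifferentiableAt I (𝓡 n) p a)
    (hτ : MDifferentiableAt I 𝓘(ℝ, ℝ) τ a) (hN : ∀ a, (p a, τ a) ∈ doubleSet δ k)
    {v : TangentSpace I a} (hv : mfderiv I (𝓡 n) p a v = 0) :
    τ a * (show ℝ from mfderiv I 𝓘(ℝ, ℝ) τ a v) = 0 := by
  let g : ℝ → ℝ := fun t ↦ t ^ 2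
  let φ : M → ℝ := fun x ↦ k - δ x
  let D : (N → ℝ) → ℝ := fun f ↦ mfderiv I 𝓘(ℝ, ℝ) f a v
  have hfun : g ∘ τ = φ ∘ p := by
    funext b
    have : δ (p b) + τ b ^ 2 - k = 0 := hN b
    change τ b ^ 2 = k - δ (p b)
    linarith
  have hφ : ContMDiff (𝓡 n) 𝓘(ℝ, ℝ) ∞ φ := contMDiff_const.sub hδ
  have h1 : D (φ ∘ p) = 0 := by
    change (show ℝ from mfderiv I 𝓘(ℝ, ℝ) (φ ∘ p) a v) = 0
    rw [mfderiv_comp a (hφ.mdifferentiable (by simp) _) hp]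
    change mfderiv (𝓡 n) 𝓘(ℝ, ℝ) φ (p a) (mfderiv I (𝓡 n) p a v) = 0
    rw [hv, map_zero]
  have hg : HasDerivAt g (2 * τ a) (τ a) := by simpa using hasDerivAt_pow 2 (τ a)
  have h2 : D (g ∘ τ) = (show ℝ from mfderiv I 𝓘(ℝ, ℝ) τ a v) * (2 * τ a) := by
    change (show ℝ from mfderiv I 𝓘(ℝ, ℝ) (g ∘ τ) a v) = _
    rw [mfderiv_comp a hg.differentiableAt.mdifferentiableAt hτ, mfderiv_eq_fderiv,
      hg.hasFDerivAt.fderiv]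
    rfl
  rw [hfun, h1] at h2
  linarith

end DoubleSection

section ExtensionExists

variable {n : ℕ} {M : Type u} [MetricSpace M] [ChartedSpace (EuclideanSpace ℝ (Fin n)) M]
  [IsManifold (𝓡 n) ∞ M] [RiemannianBundle (fun x : M ↦ TangentSpace (𝓡 n) x)]
  [IsContMDiffRiemannianBundle (𝓡 n) ∞ (EuclideanSpace ℝ (Fin n))
      (fun x : M ↦ TangentSpace (𝓡 n) x)]
  [IsRiemannianManifold (𝓡 n) M]

/-- The component of `(o, √(k - δ o))` in the double of `{δ ≤ k}`, folded by the first projection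
`p` and with the metric `p^* g + χ(τ) dτ²` for the second projection `τ`, extends every ball around
`o` on which `δ ≤ k - 1`. -/
theorem exists_isFoldedExtension {δ : M → ℝ} (hδ : ContMDiff (𝓡 n) 𝓘(ℝ, ℝ) ∞ δ)
    (hδ0 : ∀ x, 0 ≤ δ x) {k : ℝ} (hreg : ∀ x, δ x = k → mfderiv (𝓡 n) 𝓘(ℝ, ℝ) δ x ≠ 0)
    (hk : IsCompact {x | δ x ≤ k}) {o : M} {R : ℝ} (hR : 0 < R)
    (hball : ∀ x ∈ Metric.ball o R, δ x + 1 ≤ k) :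
    ∃ (N : Type u) (_ : MetricSpace N) (_ : ConnectedSpace N) (_ : CompactSpace N)
      (_ : ChartedSpace (EuclideanSpace ℝ (Fin n)) N) (_ : IsManifold (𝓡 n) ∞ N)
      (_ : RiemannianBundle (fun x : N ↦ TangentSpace (𝓡 n) x))
      (_ : IsContMDiffRiemannianBundle (𝓡 n) ∞ (EuclideanSpace ℝ (Fin n))
        (fun x : N ↦ TangentSpace (𝓡 n) x))
      (_ : IsRiemannianManifold (𝓡 n) N) (ι : M → N) (p : N → M) (τ : N → ℝ),
      IsFoldedExtension n o R ι p τ := by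
  have hoR : o ∈ Metric.ball o R := Metric.mem_ball_self hR
  have hlt : ∀ x ∈ Metric.ball o R, δ x < k := fun x hx ↦ by linarith [hball x hx]
  set Z := doubleSet δ k
  set q₀ := doubleSection δ k o
  have hq₀ : q₀ ∈ Z := doubleSection_mem (hlt o hoR).le
  have hZ : IsCompact Z := isCompact_doubleSet hδ.continuous hδ0 hk
  have hZl : LocallyConnectedSpace Z := locallyConnectedSpace_doubleSet hδ hreg
  set S := connectedComponentIn Z q₀ with hSdef
  obtain ⟨U, hU, hSU⟩ := exists_isOpen_connectedComponentIn_eq hq₀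
  have hSZ : ∀ a : S, (a : M × ℝ) ∈ Z := fun a ↦ connectedComponentIn_subset Z q₀ a.2
  have hcharts := exists_isSmoothSubsetChart_doubleSet hδ hreg hU hSU
  have hScomp : CompactSpace S := isCompact_iff_compactSpace.1
    (hZ.of_isClosed_subset (isClosed_connectedComponentIn hZ.isClosed hq₀)
      (connectedComponentIn_subset Z q₀))
  have hSconn : ConnectedSpace S := isConnected_iff_connectedSpace.1
    (isConnected_connectedComponentIn_iff.2 hq₀)
  let cS : ChartedSpace (EuclideanSpace ℝ (Fin n)) S := chartedSpaceOfSmoothSubsetCharts S hcharts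
  have hSub : IsEmbeddedSubmanifold ((𝓡 n).prod 𝓘(ℝ, ℝ)) (EuclideanSpace ℝ (Fin n)) S :=
    isEmbeddedSubmanifold_of_smoothSubsetCharts S hcharts
  have hSman : IsManifold (𝓡 n) ∞ S := hSub.isManifold
  have hSman1 : IsManifold (𝓡 n) 1 S := IsManifold.of_le (n := ∞) (by simp)
  have hval : ContMDiff (𝓡 n) ((𝓡 n).prod 𝓘(ℝ, ℝ)) ∞ (Subtype.val : S → M × ℝ) :=
    IsEmbeddedSubmanifold.contMDiff_val _ S
  let p : S → M := fun a ↦ (a : M × ℝ).1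
  let τ : S → ℝ := fun a ↦ (a : M × ℝ).2
  have hp : ContMDiff (𝓡 n) (𝓡 n) ∞ p := contMDiff_fst.comp hval
  have hτ : ContMDiff (𝓡 n) 𝓘(ℝ, ℝ) ∞ τ := contMDiff_snd.comp hval
  have hpd := hp.mdifferentiable (by simp)
  have hτd := hτ.mdifferentiable (by simp)
  -- the weight of `dτ²` is positive at the fold `τ = 0`, where `p` is not an immersion, and
  -- vanishes for `τ ≥ 1`, in particular on the copy of the ball
  let χ : S → ℝ := fun a ↦ Real.smoothTransition (1 - τ a)
  have hχ : ContMDiff (𝓡 n) 𝓘(ℝ, ℝ) ∞ χ := by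
    have h1 : ContDiff ℝ ∞ fun t : ℝ ↦ Real.smoothTransition (1 - t) :=
      Real.smoothTransition.contDiff.comp (contDiff_const.sub contDiff_id)
    exact h1.contMDiff.comp hτ
  have hχ0 : ∀ a, 0 ≤ χ a := fun a ↦ Real.smoothTransition.nonneg _
  have hpos : ∀ (a : S) (v : TangentSpace (𝓡 n) a), v ≠ 0 →
      0 < pullbackAddForm (𝓡 n) (𝓡 n) p τ χ a v v := by
    intro a v hv
    rw [pullbackAddForm_apply]
    have h1 := real_inner_self_nonneg (x := mfderiv (𝓡 n) (𝓡 n) p a v)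
    have h2 := real_inner_self_nonneg (x := mfderiv (𝓡 n) 𝓘(ℝ, ℝ) τ a v)
    by_cases hpv : mfderiv (𝓡 n) (𝓡 n) p a v = 0
    · have hτv : mfderiv (𝓡 n) 𝓘(ℝ, ℝ) τ a v ≠ 0 := by
        intro hτv
        apply hv
        apply IsEmbeddedSubmanifold.mfderiv_val_injective ((𝓡 n).prod 𝓘(ℝ, ℝ)) S a
        rw [map_zero]
        have h3 : mfderiv (𝓡 n) ((𝓡 n).prod 𝓘(ℝ, ℝ)) (fun b : S ↦ (p b, τ b)) a v = 0 := by
          rw [mfderiv_prodMk (hpd a) (hτd a)]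
          exact Prod.ext hpv hτv
        exact h3
      have h3 := mul_mfderiv_eq_zero_of_mem_doubleSet hδ (hpd a) (hτd a) hSZ hpv
      have h4 : τ a = 0 := (mul_eq_zero.1 h3).resolve_right hτv
      have h5 : χ a = 1 := by
        simp only [χ, h4, sub_zero]
        exact Real.smoothTransition.one
      have h6 := real_inner_self_pos.2 hτv
      rw [h5, one_mul]
      linarith
    · have h3 := real_inner_self_pos.2 hpv
      have h4 := mul_nonneg (hχ0 a) h2
      linarith
  let g := pullbackAddMetric hp hτ hχ hpos
  let rS : RiemannianBundle (fun x : S ↦ TangentSpace (𝓡 n) x) := ⟨g.toRiemannianMetric⟩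
  have hinner : ∀ (a : S) (v w : TangentSpace (𝓡 n) a), inner ℝ v w =
      inner ℝ (mfderiv (𝓡 n) (𝓡 n) p a v) (mfderiv (𝓡 n) (𝓡 n) p a w) +
        χ a * inner ℝ (mfderiv (𝓡 n) 𝓘(ℝ, ℝ) τ a v) (mfderiv (𝓡 n) 𝓘(ℝ, ℝ) τ a w) :=
    fun a v w ↦ pullbackAddForm_apply p τ χ a v w
  have hcR : IsContMDiffRiemannianBundle (𝓡 n) ∞ (EuclideanSpace ℝ (Fin n))
      (fun x : S ↦ TangentSpace (𝓡 n) x) := inferInstance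
  have hcont : IsContinuousRiemannianBundle (EuclideanSpace ℝ (Fin n))
      (fun x : S ↦ TangentSpace (𝓡 n) x) :=
    ⟨g.inner, g.contMDiff.continuous, fun _ _ _ ↦ rfl⟩
  have hsec : ∀ x ∈ Metric.ball o R, doubleSection δ k x ∈ S := by
    have h1 : IsPreconnected (doubleSection δ k '' Metric.ball o R) :=
      (isPreconnected_ball_of_isRiemannianManifold (𝓡 n) o R).image _ fun x hx ↦
        (contMDiffAt_doubleSection hδ (hlt x hx)).continuousAt.continuousWithinAt
    have h2 := h1.subset_connectedComponentIn (F := Z) ⟨o, hoR, rfl⟩ (by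
      rintro _ ⟨x, hx, rfl⟩
      exact doubleSection_mem (hlt x hx).le)
    exact fun x hx ↦ h2 ⟨x, hx, rfl⟩
  classical
  let ι : M → S := fun x ↦ if h : doubleSection δ k x ∈ S then ⟨_, h⟩ else
    ⟨q₀, mem_connectedComponentIn hq₀⟩
  have hι : ∀ x ∈ Metric.ball o R, (ι x : M × ℝ) = doubleSection δ k x := by
    intro x hx
    simp only [ι, dif_pos (hsec x hx)]
  have hτ1 : ∀ x ∈ Metric.ball o R, 1 ≤ τ (ι x) := by
    intro x hx
    change 1 ≤ (ι x : M × ℝ).2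
    rw [hι x hx]
    exact Real.one_le_sqrt.2 (by linarith [hball x hx])
  let mS : MetricSpace S := metricSpaceOfRiemannianMetric (𝓡 n) S
  refine ⟨S, mS, hSconn, hScomp, cS, hSman, rS, hcR,
    isRiemannianManifold_metricSpaceOfRiemannianMetric, ι, p, τ, ?_⟩
  constructor
  · intro x hx
    refine ContMDiffAt.contMDiffWithinAt ?_
    refine IsEmbeddedSubmanifold.contMDiffAt_of_val ((𝓡 n).prod 𝓘(ℝ, ℝ)) ?_
    refine (contMDiffAt_doubleSection hδ (hlt x hx)).congr_of_eventuallyEq ?_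
    filter_upwards [Metric.isOpen_ball.mem_nhds hx] with y hy using hι y hy
  · exact hp
  · exact hτ.continuous
  · intro x hx
    change (ι x : M × ℝ).1 = x
    rw [hι x hx]
    rfl
  · exact fun x hx ↦ zero_lt_one.trans_le (hτ1 x hx)
  · intro a ha h0
    have h1 : δ (p a) + τ a ^ 2 - k = 0 := hSZ a
    rw [h0] at h1
    linarith [hball _ ha]
  · intro a ha ha0
    apply Subtype.ext
    rw [hι _ ha]
    exact doubleSection_fst_of_mem (hSZ a) ha0
  · intro x hx v w
    have h1 : χ (ι x) = 0 := Real.smoothTransition.zero_of_nonpos (by linarith [hτ1 x hx])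
    rw [hinner, h1, zero_mul, add_zero]
  · intro a v
    refine le_of_sq_le_sq ?_ (norm_nonneg _)
    rw [← real_inner_self_eq_norm_sq, ← real_inner_self_eq_norm_sq, hinner]
    have := mul_nonneg (hχ0 a) (real_inner_self_nonneg (x := mfderiv (𝓡 n) 𝓘(ℝ, ℝ) τ a v))
    linarith

end ExtensionExists

/-! ### The compact extension of `D_m` -/

theorem lemma7p1 (n : ℕ) (M : Type u) [MetricSpace M] [ConnectedSpace M] [CompleteSpace M]
    [ChartedSpace (EuclideanSpace ℝ (Fin n)) M] [IsManifold (𝓡 n) ∞ M]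
    [RiemannianBundle (fun x : M ↦ TangentSpace (𝓡 n) x)]
    [IsContMDiffRiemannianBundle (𝓡 n) ∞ (EuclideanSpace ℝ (Fin n))
      (fun x : M ↦ TangentSpace (𝓡 n) x)]
    [IsRiemannianManifold (𝓡 n) M]
    (o : M) (δ : M → ℝ) (hδ : IsApproxDistance n o δ) (m : ℕ) :
    ∃ (N : Type u) (_ : MetricSpace N) (_ : ConnectedSpace N) (_ : CompactSpace N)
      (_ : ChartedSpace (EuclideanSpace ℝ (Fin n)) N) (_ : IsManifold (𝓡 n) ∞ N)
      (_ : RiemannianBundle (fun x : N ↦ TangentSpace (𝓡 n) x))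
      (_ : IsContMDiffRiemannianBundle (𝓡 n) ∞ (EuclideanSpace ℝ (Fin n))
        (fun x : N ↦ TangentSpace (𝓡 n) x))
      (_ : IsRiemannianManifold (𝓡 n) N) (ι : M → N),
      IsIsometricOpenEmbeddingOn n ι (exhaustionDomain δ m) ∧
      ∀ x ∈ exhaustionDomain δ m, ∀ y ∈ exhaustionDomain δ m,
        x ∉ cutLocus n y → ι x ∉ cutLocus n (ι y) := by
  have : LocallyCompactSpace M :=
    ChartedSpace.locallyCompactSpace (EuclideanSpace ℝ (Fin n)) M
  have : ProperSpace M := (hasApproxIntermediatePoints_of_isRiemannianManifold (𝓡 n) M).properSpace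
  -- `D_m` lies in the ball of radius `r = 2m + 2`; the extension is needed on the ball of radius
  -- `9r + 3`, on which `δ + 1 < (9r + 3) / 2 + 2 < k`
  let k : ℕ := 9 * m + 13
  have habs : ∀ x, δ x < dist x o / 2 + 1 ∧ dist x o / 2 < δ x + 1 := by
    intro x
    have h1 := abs_lt.1 (hδ.abs_sub_lt x)
    rw [dist_comm] at h1
    constructor <;> linarith
  have hk : IsCompact {x | δ x ≤ (k : ℝ)} := by
    refine (isCompact_closedBall o (2 * k + 2 : ℝ)).of_isClosed_subset
      (isClosed_le hδ.smooth.continuous continuous_const) fun x hx ↦ ?_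
    have hx' : δ x ≤ k := hx
    rw [Metric.mem_closedBall]
    linarith [(habs x).2]
  have hD : exhaustionDomain δ m ⊆ Metric.ball o (2 * m + 2 : ℝ) := by
    intro x hx
    have hx' : δ x < m := hx
    rw [Metric.mem_ball]
    linarith [(habs x).2]
  have hm : (0 : ℝ) ≤ m := m.cast_nonneg
  obtain ⟨N, i1, i2, i3, i4, i5, i6, i7, i8, ι, p, τ, h⟩ :=
    exists_isFoldedExtension hδ.smooth hδ.nonneg (k := (k : ℝ))
      (hδ.regular k (by simp only [k]; omega)) hk (o := o) (R := 9 * (2 * m + 2) + 3)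
      (by positivity) (by
        intro x hx
        rw [Metric.mem_ball] at hx
        have := (habs x).1
        simp only [k]
        push_cast
        linarith)
  refine ⟨N, i1, i2, i3, i4, i5, i6, i7, i8, ι, h.isIsometricOpenEmbeddingOn ?_ ?_, ?_⟩
  · exact isOpen_lt hδ.smooth.continuous continuous_const
  · exact hD.trans (Metric.ball_subset_ball (by linarith))
  · exact fun x hx y hy hxy ↦ h.notMem_cutLocus le_rfl (hD hx) (hD hy) hxy
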